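/- All graphs are finite and simple. An induced cycle in a graph is an induced subgraph that is a cycle (of length at least $3$); a hole is an induced cycle of length at least $4$, and it is odd if its length (number of edges) is odd. A graph is called pentagonal if every induced odd cycle in it has length exactly five (in particular, it contains no triangle). Every pentagonal graph has chromatic number at most $58000$. Consequently, Gyárfás's conjecture, which asserts that for all integers $k,\ell$ there exists $n(k,\ell)$ such that every graph with no clique of cardinality more than $k$ and no odd hole of length more than $\ell$ has chromatic number at most $n(k,\ell)$, holds in the case $(k,\ell)=(2,5)$: there is an integer $N$ such that every graph with no clique of cardinality more than $2$ and no odd hole of length more than $5$ has chromatic number at most $N$. -/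

import Mathlib

universe u

namespace GyarfasHoles

/-- `G` has an induced subgraph which is a cycle of length `n`. A cycle has at least three vertices;
this is required explicitly because `SimpleGraph.cycleGraph n` is not a cycle for `n ≤ 2`. -/
def HasInducedCycle {V : Type u} (G : SimpleGraph V) (n : ℕ) : Prop :=
  3 ≤ n ∧ (SimpleGraph.cycleGraph n).IsIndContained G

/-- `G` has a hole of length `n`: an induced subgraph which is a cycle of length `n ≥ 4`. -/
def HasHole {V : Type u} (G : SimpleGraph V) (n : ℕ) : Prop :=
  4 ≤ n ∧ HasInducedCycle G n

/-- A graph is pentagonal if every induced odd cycle in it has length five. -/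
def Pentagonal {V : Type u} (G : SimpleGraph V) : Prop :=
  ∀ n : ℕ, Odd n → HasInducedCycle G n → n = 5

/-- The assertion of Gyárfás's conjecture for the pair `(k, ℓ)`: there is a number `N` such that every
finite graph with no clique of cardinality more than `k` and no odd hole of length more than `ℓ`
has chromatic number at most `N`. -/
def GyarfasConjecture (k ℓ : ℕ) : Prop :=
  ∃ N : ℕ, ∀ (V : Type u) [Finite V] (G : SimpleGraph V),
    (∀ s : Finset V, G.IsClique (s : Set V) → s.card ≤ k) →
    (∀ n : ℕ, Odd n → HasHole G n → n ≤ ℓ) →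
    G.chromaticNumber ≤ (N : ℕ∞)

end GyarfasHoles

/-! Every parity conflict is fatal in a pentagonal graph. If two induced paths with lengths of
opposite parity can be closed to induced cycles, one cycle is odd, so it has length five; the paths
below are long enough to exclude this. Moreover a shortest odd closed walk traverses an induced odd
cycle, so a set containing no pentagon is bipartite (`Pentagonal.colOn_two`). To colour a set it is
therefore enough to discard pieces of bounded chromatic number until no pentagon survives.

The first ingredient is that bounded second neighbourhoods bound the whole graph
(`Pentagonal.colOn_univ_of_N2`). Consider a distance level `C`, its parent level `A`, the level `Y`
before that, and the connected ball `K` below. Number `C` by a choice of parents, preferring parents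
with few neighbours in `Y`. A vertex is active if it is attached to a connected set of later
vertices of large chromatic number; the other vertices are cheap to colour (`colOn_nonactive`). From
a pentagon of active vertices an induced path can leave through later vertices, descend through the
parent of a far vertex towards `Y` and `K`, and come back through chosen parents of pentagon
vertices. The far vertex lies outside the second neighbourhoods of the vertices involved, which
keeps the path induced. Different ways of coming back give both parities (`Indexed.no_active_pent`).

The second ingredient bounds second neighbourhoods nested three deep
(`Pentagonal.colOn_three_covers`). After cheap deletions, what remains is covered by three sets with
no induced path of positive even interior from one to another, and this excludes pentagons
(`no_pent_of_three_covers`). Applying the first ingredient at each depth brings the bound back to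
the whole graph. -/

namespace GyarfasHoles

open SimpleGraph

variable {V : Type u} {G : SimpleGraph V}

/-! ### Colouring vertex subsets -/

/-- The set `S` can be properly coloured with `n` colours. -/
def ColOn (G : SimpleGraph V) (S : Set V) (n : ℕ) : Prop :=
  ∃ f : V → ℕ, (∀ v ∈ S, f v < n) ∧ ∀ u ∈ S, ∀ v ∈ S, G.Adj u v → f u ≠ f v

theorem ColOn.mono {S T : Set V} {m n : ℕ} (h : ColOn G T m) (hST : S ⊆ T) (hmn : m ≤ n) :
    ColOn G S n := by
  obtain ⟨f, h1, h2⟩ := h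
  exact ⟨f, fun v hv => (h1 v (hST hv)).trans_le hmn,
    fun u hu v hv => h2 u (hST hu) v (hST hv)⟩

theorem ColOn.union {S T : Set V} {m n : ℕ} (hS : ColOn G S m) (hT : ColOn G T n) :
    ColOn G (S ∪ T) (m + n) := by
  classical
  obtain ⟨f, f1, f2⟩ := hS
  obtain ⟨g, g1, g2⟩ := hT
  refine ⟨fun v => if v ∈ S then f v else m + g v, ?_, ?_⟩
  · intro v hv
    by_cases h : v ∈ S
    · simp only [h, if_true]
      have := f1 v h
      omega
    · simp only [h, if_false]
      have := g1 v (hv.resolve_left h)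
      omega
  · intro u hu v hv huv
    by_cases h : u ∈ S <;> by_cases h' : v ∈ S <;> simp only [h, h', if_true, if_false]
    · exact f2 u h v h' huv
    · have := f1 u h
      omega
    · have := f1 v h'
      omega
    · have := g2 u (hu.resolve_left h) v (hv.resolve_left h') huv
      omega

theorem colOn_one_of_stable {S : Set V} (h : ∀ u ∈ S, ∀ v ∈ S, ¬ G.Adj u v) : ColOn G S 1 :=
  ⟨fun _ => 0, fun _ _ => Nat.one_pos, fun u hu v hv huv => (h u hu v hv huv).elim⟩

theorem colOn_empty (n : ℕ) : ColOn G ∅ n :=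
  ⟨fun _ => 0, fun _ h => h.elim, fun _ h => h.elim⟩

theorem ColOn.cover {S T U : Set V} {m n k : ℕ} (hS : ColOn G S m) (hT : ColOn G T n)
    (h : U ⊆ S ∪ T) (hk : m + n ≤ k) : ColOn G U k :=
  (hS.union hT).mono h hk

theorem colOn_iff_induce {S : Set V} {n : ℕ} :
    ColOn G S n ↔ ColOn (G.induce S) Set.univ n := by
  classical
  constructor
  · rintro ⟨f, h1, h2⟩
    exact ⟨fun v => f v, fun v _ => h1 v v.2, fun u _ v _ huv => h2 u u.2 v v.2 huv⟩
  · rintro ⟨f, h1, h2⟩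
    refine ⟨fun v => if h : v ∈ S then f ⟨v, h⟩ else 0, ?_, ?_⟩
    · intro v hv
      simpa [hv] using h1 ⟨v, hv⟩ trivial
    · intro u hu v hv huv
      simpa [hu, hv] using h2 ⟨u, hu⟩ trivial ⟨v, hv⟩ trivial huv

theorem colOn_univ_iff {n : ℕ} : ColOn G Set.univ n ↔ G.Colorable n := by
  constructor
  · rintro ⟨f, h1, h2⟩
    exact ⟨Coloring.mk (fun v => ⟨f v, h1 v trivial⟩)
      (fun {u v} huv h => h2 u trivial v trivial huv (by simpa using h))⟩
  · rintro ⟨C⟩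
    exact ⟨fun v => C v, fun v _ => (C v).2,
      fun u _ v _ huv h => C.valid huv (Fin.ext h)⟩

/-! ### Connected sets, components and exits -/

/-- The set `U` induces a connected subgraph: it has no proper nonempty subset which is closed under
taking neighbours in `U`. -/
def ConnOn (G : SimpleGraph V) (U : Set V) : Prop :=
  ∀ A ⊆ U, A.Nonempty → (∀ a ∈ A, ∀ q ∈ U, G.Adj a q → q ∈ A) → U ⊆ A

theorem connOn_singleton (v : V) : ConnOn G {v} := by
  rintro A hA ⟨a, ha⟩ - x hx
  obtain rfl := hA ha
  obtain rfl := hx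
  exact ha

theorem ConnOn.union {U Y : Set V} (hU : ConnOn G U) (hY : ∀ y ∈ Y, ∃ u ∈ U, G.Adj y u) :
    ConnOn G (U ∪ Y) := by
  rintro A hA ⟨a, ha⟩ hcl
  have key : ∃ u ∈ U, u ∈ A := by
    rcases hA ha with h | h
    · exact ⟨a, h, ha⟩
    · obtain ⟨u, hu, hau⟩ := hY a h
      exact ⟨u, hu, hcl a ha u (Or.inl hu) hau⟩
  obtain ⟨u, hu, huA⟩ := key
  have hUA : U ⊆ A := by
    have := hU (A ∩ U) Set.inter_subset_right ⟨u, huA, hu⟩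
      (fun a ha q hq haq => ⟨hcl a ha.1 q (Or.inl hq) haq, hq⟩)
    exact fun x hx => (this hx).1
  rintro x (hx | hx)
  · exact hUA hx
  · obtain ⟨w, hw, hxw⟩ := hY x hx
    exact hcl w (hUA hw) x (Or.inr hx) hxw.symm

theorem ConnOn.insert {U : Set V} {y u : V} (hU : ConnOn G U) (hu : u ∈ U) (hy : G.Adj y u) :
    ConnOn G (insert y U) := by
  have := hU.union (Y := {y}) (by rintro _ rfl; exact ⟨u, hu, hy⟩)
  rwa [Set.union_singleton] at this

/-- The component of the subgraph induced on `S` which contains `v`. -/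
def comp (G : SimpleGraph V) (S : Set V) (v : V) : Set V :=
  {x | ∀ A ⊆ S, v ∈ A → (∀ a ∈ A, ∀ q ∈ S, G.Adj a q → q ∈ A) → x ∈ A}

theorem mem_comp_self {S : Set V} {v : V} : v ∈ comp G S v := fun _ _ h _ => h

theorem comp_subset {S : Set V} {v : V} (hv : v ∈ S) : comp G S v ⊆ S :=
  fun _ hx => hx S subset_rfl hv (fun _ _ _ hq _ => hq)

theorem comp_closed {S : Set V} {v a q : V} (ha : a ∈ comp G S v) (hq : q ∈ S)
    (haq : G.Adj a q) : q ∈ comp G S v :=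
  fun A hA hv hcl => hcl a (ha A hA hv hcl) q hq haq

theorem connOn_comp {S : Set V} {v : V} (hv : v ∈ S) : ConnOn G (comp G S v) := by
  intro A hA hne hcl
  by_cases hvA : v ∈ A
  · intro x hx
    exact hx A (hA.trans (comp_subset hv)) hvA
      (fun a ha q hq haq => hcl a ha q (comp_closed (hA ha) hq haq) haq)
  · exfalso
    obtain ⟨a, ha⟩ := hne
    have := hA ha (comp G S v \ A) (Set.sdiff_subset.trans (comp_subset hv))
      ⟨mem_comp_self, hvA⟩
      (fun b hb q hq hbq => ⟨comp_closed hb.1 hq hbq,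
        fun hqA => hb.2 (hcl q hqA b hb.1 hbq.symm)⟩)
    exact this.2 ha

theorem comp_eq_of_adj {S : Set V} {u v : V} (hu : u ∈ S) (hv : v ∈ S) (h : G.Adj u v) :
    comp G S u = comp G S v := by
  have key : ∀ {u v : V}, u ∈ S → v ∈ S → G.Adj u v → comp G S u ⊆ comp G S v := by
    intro u v hu hv h x hx
    exact hx _ (comp_subset hv) (comp_closed mem_comp_self hu h.symm)
      (fun a ha q hq haq => comp_closed ha hq haq)
  exact (key hu hv h).antisymm (key hv hu h.symm)

theorem colOn_of_comp {S : Set V} {n : ℕ} (h : ∀ v ∈ S, ColOn G (comp G S v) n) :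
    ColOn G S n := by
  classical
  have h' : ∀ Q : Set V, ∃ f : V → ℕ, (∃ v ∈ S, Q = comp G S v) →
      (∀ v ∈ Q, f v < n) ∧ ∀ u ∈ Q, ∀ v ∈ Q, G.Adj u v → f u ≠ f v := by
    intro Q
    by_cases hQ : ∃ v ∈ S, Q = comp G S v
    · obtain ⟨v, hv, rfl⟩ := hQ
      obtain ⟨f, hf⟩ := h v hv
      exact ⟨f, fun _ => hf⟩
    · exact ⟨fun _ => 0, fun h => (hQ h).elim⟩
  choose f hf using h'
  refine ⟨fun v => f (comp G S v) v, ?_, ?_⟩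
  · intro v hv
    exact (hf _ ⟨v, hv, rfl⟩).1 v mem_comp_self
  · intro u hu v hv huv
    have e := comp_eq_of_adj hu hv huv
    simp only [e]
    exact (hf _ ⟨v, hv, rfl⟩).2 u (e ▸ mem_comp_self) v mem_comp_self huv

theorem exists_comp_of_not_colOn {S : Set V} {n : ℕ} (h : ¬ ColOn G S n) :
    ∃ Q ⊆ S, ConnOn G Q ∧ ¬ ColOn G Q n ∧ ∀ a ∈ Q, ∀ q ∈ S, G.Adj a q → q ∈ Q := by
  by_contra! hc
  apply h
  apply colOn_of_comp
  intro v hv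
  by_contra hn
  obtain ⟨a, ha, q, hq, haq, hqn⟩ := hc _ (comp_subset hv) (connOn_comp hv) hn
  exact hqn (comp_closed ha hq haq)

theorem nonempty_of_not_colOn {S : Set V} {n : ℕ} (h : ¬ ColOn G S n) : S.Nonempty := by
  rw [Set.nonempty_iff_ne_empty]
  rintro rfl
  exact h (colOn_empty n)

/-- A connected set `X` meeting the neighbourhood `N` of something contains a connected set which
avoids `N`, still has large chromatic number, and is attached to a vertex of `N`. -/
theorem ConnOn.exists_exit {X N : Set V} {m n : ℕ} (hX : ConnOn G X) (hN : (X ∩ N).Nonempty)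
    (hXm : ¬ ColOn G X (m + n)) (hn : ColOn G (X ∩ N) n) :
    ∃ X₁ ⊆ X \ N, ConnOn G X₁ ∧ ¬ ColOn G X₁ m ∧ ∃ x ∈ X ∩ N, ∃ q ∈ X₁, G.Adj x q := by
  have h1 : ¬ ColOn G (X \ N) m := by
    intro h
    refine hXm (h.cover hn ?_ le_rfl)
    intro x hx
    by_cases hxN : x ∈ N
    · exact Or.inr ⟨hx, hxN⟩
    · exact Or.inl ⟨hx, hxN⟩
  obtain ⟨Q, hQ, hQc, hQm, hQcl⟩ := exists_comp_of_not_colOn h1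
  refine ⟨Q, hQ, hQc, hQm, ?_⟩
  by_contra! hno
  have := hX Q (fun x hx => (hQ hx).1) (nonempty_of_not_colOn hQm) (by
    intro a ha q hq haq
    by_cases hqN : q ∈ N
    · exact (hno q ⟨hq, hqN⟩ a ha haq.symm).elim
    · exact hQcl a ha q ⟨hq, hqN⟩ haq)
  obtain ⟨x, hx, hxN⟩ := hN
  exact (hQ (this hx)).2 hxN

/-- Vertices which are not attached to a later connected set of large chromatic number
induce a subgraph of small chromatic number. -/
theorem colOn_nonactive [Finite V] {C R : Set V} {idx : V → ℕ} {c : ℕ}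
    (hidx : ∀ t, ∀ u ∈ C, ∀ v ∈ C, idx u = t → idx v = t → ¬ G.Adj u v) (hR : R ⊆ C)
    (hna : ∀ v ∈ R, ∀ X ⊆ C, ConnOn G X → (∀ x ∈ X, idx v < idx x) → (∃ x ∈ X, G.Adj v x) →
      ColOn G X c) : ColOn G R (c + 1) := by
  classical
  refine colOn_of_comp (fun v hv => ?_)
  set R₀ := comp G R v with hR₀
  have hconn : ConnOn G R₀ := connOn_comp hv
  have hsub : R₀ ⊆ R := comp_subset hv
  have hex : ∃ t, ColOn G {x ∈ R₀ | t < idx x} c := by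
    obtain ⟨M, hM⟩ := (Set.finite_range idx).bddAbove
    refine ⟨M, (colOn_empty c).mono ?_ le_rfl⟩
    rintro x ⟨-, hx⟩
    exact (not_lt.2 (hM ⟨x, rfl⟩) hx).elim
  have hstab : ∀ t, ColOn G {x ∈ R₀ | idx x = t} 1 := fun t =>
    colOn_one_of_stable (fun u hu v hv => hidx t u (hR (hsub hu.1)) v (hR (hsub hv.1)) hu.2 hv.2)
  -- By minimality of `t`, the vertices of index at least `t` contain a component `Q` that is not
  -- `c`-colourable. A neighbour of `Q` in `R₀` of smaller index would be attached to a later set,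
  -- which `hna` forbids. So `Q` is all of `R₀`, and one extra colour for index `t` suffices.
  set t := Nat.find hex with ht
  have htc : ColOn G {x ∈ R₀ | t < idx x} c := Nat.find_spec hex
  refine htc.cover (hstab t) ?_ le_rfl
  rcases Nat.eq_zero_or_pos t with h0 | hpos
  · intro x hx
    rcases Nat.eq_zero_or_pos (idx x) with h | h
    · exact Or.inr ⟨hx, by omega⟩
    · exact Or.inl ⟨hx, by omega⟩
  · have hn : ¬ ColOn G {x ∈ R₀ | t - 1 < idx x} c := Nat.find_min hex (by omega)
    obtain ⟨Q, hQ, hQc, hQn, hQcl⟩ := exists_comp_of_not_colOn hn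
    have hall := hconn Q (fun x hx => (hQ hx).1) (nonempty_of_not_colOn hQn) (by
      intro a ha q hq haq
      by_cases hqt : t - 1 < idx q
      · exact hQcl a ha q ⟨hq, hqt⟩ haq
      · exfalso
        refine hQn (hna q (hsub hq) Q (fun x hx => hR (hsub (hQ hx).1)) hQc ?_
          ⟨a, ha, haq.symm⟩)
        intro x hx
        exact (not_lt.1 hqt).trans_lt (hQ hx).2)
    intro x hx
    have := (hQ (hall hx)).2
    rcases Nat.lt_or_ge t (idx x) with h | h
    · exact Or.inl ⟨hx, h⟩
    · exact Or.inr ⟨hx, by omega⟩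

/-! ### Induced cycles and induced paths -/

/-- For `i < j < n` the equation `i + n = j + 1` forces `i = 0` and `j = n - 1`: it encodes the
closing edge. -/
theorem hasInducedCycle_of_fun {n : ℕ} (hn : 3 ≤ n) (c : ℕ → V)
    (hc : ∀ i j, i < j → j < n → c i ≠ c j ∧ (G.Adj (c i) (c j) ↔ j = i + 1 ∨ i + n = j + 1)) :
    HasInducedCycle G n := by
  have key : ∀ i j : Fin n, i < j → ((cycleGraph n).Adj i j ↔ j.val = i.val + 1 ∨ i.val + n = j.val + 1) := by
    intro i j hij
    rw [cycleGraph_adj']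
    have hi := i.2
    have hj := j.2
    have hij' : i.val < j.val := hij
    have h1 : (j - i).val = j.val - i.val := Fin.sub_val_of_le hij.le
    have h2 : (i - j).val = n - j.val + i.val := by
      rw [Fin.sub_def]
      exact Nat.mod_eq_of_lt (by omega)
    omega
  refine ⟨hn, ⟨⟨⟨fun i => c i, ?_⟩, ?_⟩⟩⟩
  · intro i j hij
    rcases lt_trichotomy i j with h | h | h
    · exact ((hc i j h j.2).1 hij).elim
    · exact h
    · exact ((hc j i h i.2).1 hij.symm).elim
  · intro i j
    change G.Adj (c i) (c j) ↔ (cycleGraph n).Adj i j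
    rcases lt_trichotomy i j with h | h | h
    · rw [key i j h, (hc i j h j.2).2]
    · subst h; simp
    · rw [adj_comm, (cycleGraph n).adj_comm, key j i h, (hc j i h i.2).2]

theorem Pentagonal.not_triangle (hG : Pentagonal G) {a b c : V} (hab : G.Adj a b)
    (hbc : G.Adj b c) (hac : G.Adj a c) : False := by
  have := hG 3 (by decide) (hasInducedCycle_of_fun le_rfl
    (fun i => if i = 0 then a else if i = 1 then b else c) (by
      intro i j hij hj
      have : (i = 0 ∧ j = 1) ∨ (i = 0 ∧ j = 2) ∨ (i = 1 ∧ j = 2) := by omega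
      rcases this with ⟨rfl, rfl⟩ | ⟨rfl, rfl⟩ | ⟨rfl, rfl⟩
      · simp [hab, hab.ne]
      · simp [hac, hac.ne]
      · simp [hbc, hbc.ne]))
  omega

/-- The vertices `r` and `a` are distinct and nonadjacent. -/
def Sep (G : SimpleGraph V) (r a : V) : Prop := a ≠ r ∧ ¬ G.Adj r a

theorem Sep.symm {r a : V} (h : Sep G r a) : Sep G a r := ⟨h.1.symm, fun k => h.2 k.symm⟩

/-- The vertex `r` is outside `I` and has no neighbour in `I`. -/
def Far (G : SimpleGraph V) (r : V) (I : Set V) : Prop := ∀ v ∈ I, Sep G r v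

theorem Far.mono {r : V} {I J : Set V} (h : Far G r J) (hI : I ⊆ J) : Far G r I :=
  fun v hv => h v (hI hv)

theorem Far.insert {r a : V} {I : Set V} (h : Far G r I) (h1 : Sep G r a) :
    Far G r (insert a I) := by
  rintro v (rfl | hv)
  · exact h1
  · exact h v hv

theorem Far.union {r : V} {I J : Set V} (h : Far G r I) (h' : Far G r J) :
    Far G r (I ∪ J) := by
  rintro v (hv | hv)
  · exact h v hv
  · exact h' v hv

theorem far_empty {r : V} : Far G r ∅ := fun _ h => h.elim

/-- There is an induced path from `x` to `e` with exactly `n` interior vertices,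
all of which belong to `I`. -/
def Pth (G : SimpleGraph V) (x e : V) (I : Set V) (n : ℕ) : Prop :=
  ∃ c : ℕ → V, c 0 = x ∧ c (n + 1) = e ∧ (∀ i, 0 < i → i ≤ n → c i ∈ I) ∧
    ∀ i j, i < j → j ≤ n + 1 → c i ≠ c j ∧ (G.Adj (c i) (c j) ↔ j = i + 1)

theorem Pth.mono {x e : V} {I J : Set V} {n : ℕ} (h : Pth G x e I n) (hI : I ⊆ J) :
    Pth G x e J n := by
  obtain ⟨c, h1, h2, h3, h4⟩ := h
  exact ⟨c, h1, h2, fun i hi hn => hI (h3 i hi hn), h4⟩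

theorem pth_of_adj {x e : V} (I : Set V) (h : G.Adj x e) : Pth G x e I 0 := by
  refine ⟨fun i => if i = 0 then x else e, rfl, rfl, fun i _ _ => by omega, ?_⟩
  intro i j hij hj
  obtain ⟨rfl, rfl⟩ : i = 0 ∧ j = 1 := by omega
  simp [h, h.ne]

theorem Pth.adj {x e : V} {I : Set V} (h : Pth G x e I 0) : G.Adj x e := by
  obtain ⟨c, rfl, rfl, h3, h4⟩ := h
  exact (h4 0 1 (by omega) le_rfl).2.2 rfl

theorem Pth.common_nbr {x e : V} {I : Set V} (h : Pth G x e I 1) :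
    ∃ v ∈ I, G.Adj x v ∧ G.Adj v e := by
  obtain ⟨c, rfl, rfl, h3, h4⟩ := h
  exact ⟨c 1, h3 1 (by omega) le_rfl, (h4 0 1 (by omega) (by omega)).2.2 rfl,
    (h4 1 2 (by omega) le_rfl).2.2 rfl⟩

theorem Pth.two_nbrs {x e : V} {I : Set V} (h : Pth G x e I 2) :
    ∃ v ∈ I, ∃ w ∈ I, G.Adj x v ∧ G.Adj v w ∧ G.Adj w e := by
  obtain ⟨c, rfl, rfl, h3, h4⟩ := h
  exact ⟨c 1, h3 1 (by omega) (by omega), c 2, h3 2 (by omega) (by omega),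
    (h4 0 1 (by omega) (by omega)).2.2 rfl,
    (h4 1 2 (by omega) (by omega)).2.2 rfl, (h4 2 3 (by omega) le_rfl).2.2 rfl⟩

theorem Pth.snoc {x e r : V} {I : Set V} {n : ℕ} (h : Pth G x e I n) (hr : G.Adj r e)
    (hrx : Sep G r x) (hI : Far G r I) : Pth G x r (insert e I) (n + 1) := by
  obtain ⟨c, h1, h2, h3, h4⟩ := h
  refine ⟨fun i => if i ≤ n + 1 then c i else r, by simp [h1], by simp, ?_, ?_⟩
  · intro i hi hn
    simp only [hn, if_true]
    rcases Nat.lt_or_ge n i with h | h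
    · obtain rfl : i = n + 1 := by omega
      exact Or.inl h2
    · exact Or.inr (h3 i hi h)
  · intro i j hij hj
    have hi : i ≤ n + 1 := by omega
    simp only [hi, if_true]
    by_cases hj' : j ≤ n + 1
    · simp only [hj', if_true]
      exact h4 i j hij hj'
    · simp only [hj', if_false]
      have hjj : j = n + 2 := by omega
      rcases Nat.eq_zero_or_pos i with rfl | hi0
      · rw [h1]
        refine ⟨hrx.1, fun h => (hrx.2 h.symm).elim, fun h => by omega⟩
      · rcases Nat.lt_or_ge n i with h | h
        · obtain rfl : i = n + 1 := by omega
          rw [h2]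
          exact ⟨hr.ne', fun _ => hjj, fun _ => hr.symm⟩
        · obtain ⟨k1, k2⟩ := hI _ (h3 i hi0 h)
          exact ⟨k1, fun h => (k2 h.symm).elim, fun h => by omega⟩

theorem Pth.join {x e f : V} {I J : Set V} {n m : ℕ} (h : Pth G x e I n) (h' : Pth G e f J m)
    (hxf : Sep G x f) (hxJ : Far G x J) (hfI : Far G f I) (hIJ : ∀ v ∈ I, Far G v J) :
    Pth G x f (insert e (I ∪ J)) (n + m + 1) := by
  obtain ⟨c, h1, h2, h3, h4⟩ := h
  obtain ⟨d, k1, k2, k3, k4⟩ := h'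
  refine ⟨fun i => if i ≤ n + 1 then c i else d (i - (n + 1)), by simp [h1], ?_, ?_, ?_⟩
  · have : ¬ (n + m + 1 + 1 ≤ n + 1) := by omega
    simp only [this, if_false]
    rw [← k2]
    congr 1
    omega
  · intro i hi hn
    dsimp only
    split_ifs with hi'
    · rcases Nat.lt_or_ge n i with h | h
      · obtain rfl : i = n + 1 := by omega
        exact Or.inl h2
      · exact Or.inr (Or.inl (h3 i hi h))
    · exact Or.inr (Or.inr (k3 _ (by omega) (by omega)))
  · intro i j hij hj
    dsimp only
    split_ifs with hi' hj' hj'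
    · exact h4 i j hij hj'
    · have hf : c i ≠ d (j - (n + 1)) ∧ ¬ G.Adj (c i) (d (j - (n + 1))) ∨ i = n + 1 := by
        by_cases hin : i = n + 1
        · exact Or.inr hin
        left
        rcases Nat.eq_zero_or_pos i with rfl | hi0
        · rw [h1]
          by_cases hjm : j - (n + 1) = m + 1
          · rw [hjm, k2]
            exact ⟨hxf.1.symm, hxf.2⟩
          · obtain ⟨a1, a2⟩ := hxJ _ (k3 (j - (n + 1)) (by omega) (by omega))
            exact ⟨a1.symm, a2⟩
        · have hi1 := h3 i hi0 (by omega)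
          by_cases hjm : j - (n + 1) = m + 1
          · rw [hjm, k2]
            obtain ⟨a1, a2⟩ := hfI _ hi1
            exact ⟨a1, fun h => a2 h.symm⟩
          · obtain ⟨a1, a2⟩ := hIJ _ hi1 _ (k3 (j - (n + 1)) (by omega) (by omega))
            exact ⟨a1.symm, a2⟩
      rcases hf with hf | rfl
      · exact ⟨hf.1, fun h => (hf.2 h).elim, fun h => by
          obtain rfl : i = n + 1 := by omega
          have e1 : j - (n + 1) = 1 := by omega
          rw [e1, h2, ← k1] at hf
          exact (hf.2 ((k4 0 1 (by omega) (by omega)).2.2 rfl)).elim⟩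
      · rw [h2, ← k1]
        obtain ⟨a1, a2⟩ := k4 0 (j - (n + 1)) (by omega) (by omega)
        refine ⟨a1, ?_⟩
        rw [a2]
        omega
    · omega
    · obtain ⟨a1, a2⟩ := k4 (i - (n + 1)) (j - (n + 1)) (by omega) (by omega)
      refine ⟨a1, ?_⟩
      rw [a2]
      omega

/-- Closing an induced path to an induced cycle. -/
theorem Pth.close (hG : Pentagonal G) {x e w : V} {I : Set V} {n : ℕ} (h : Pth G x e I n)
    (hx : G.Adj w x) (he : G.Adj w e) (hI : Far G w I) : n % 2 = 0 → n = 2 := by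
  intro hn
  obtain ⟨c, h1, h2, h3, h4⟩ := h
  have := hG (n + 3) (by rw [Nat.odd_iff]; omega) (hasInducedCycle_of_fun (by omega)
    (fun i => if i ≤ n + 1 then c i else w) (by
      intro i j hij hj
      have hi : i ≤ n + 1 := by omega
      simp only [hi, if_true]
      by_cases hj' : j ≤ n + 1
      · simp only [hj', if_true]
        obtain ⟨a1, a2⟩ := h4 i j hij hj'
        refine ⟨a1, ?_⟩
        rw [a2]
        omega
      · simp only [hj', if_false]
        obtain rfl : j = n + 2 := by omega
        rcases Nat.eq_zero_or_pos i with rfl | hi0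
        · rw [h1]
          exact ⟨hx.ne', fun _ => by omega, fun _ => hx.symm⟩
        · rcases Nat.lt_or_ge n i with h | h
          · obtain rfl : i = n + 1 := by omega
            rw [h2]
            exact ⟨he.ne', fun _ => by omega, fun _ => he.symm⟩
          · obtain ⟨k1, k2⟩ := hI _ (h3 i hi0 h)
            exact ⟨k1, fun h => (k2 h.symm).elim, fun h => by omega⟩))
  omega

theorem Pth.truncate {x v : V} {I : Set V} {c : ℕ → V} {n i : ℕ} (h1 : c 0 = x)
    (h3 : ∀ i, 0 < i → i ≤ n → c i ∈ I)
    (h4 : ∀ i j, i < j → j ≤ n + 1 → c i ≠ c j ∧ (G.Adj (c i) (c j) ↔ j = i + 1))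
    (hi : i ≤ n) (hv : c (i + 1) = v) : Pth G x v I i :=
  ⟨c, h1, hv, fun j hj hji => h3 j hj (by omega), fun j k hjk hk => h4 j k hjk (by omega)⟩

/-- An induced path ending at `u` and a neighbour `v` of `u` off the path: the first
neighbour of `v` on the path gives an induced path to `v`. -/
theorem Pth.extend {x u v : V} {I : Set V} {n : ℕ} (h : Pth G x u I n) (huv : G.Adj v u)
    (hvx : v ≠ x) (hvI : v ∉ I) :
    Pth G x v (insert u I) (n + 1) ∨
    ∃ i, Pth G x v I i ∧ ((∃ w, G.Adj w u ∧ G.Adj w v) ∨ Pth G x u (insert v I) (i + 1)) := by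
  classical
  obtain ⟨c, h1, h2, h3, h4⟩ := h
  have hex : ∃ i, G.Adj v (c i) := ⟨n + 1, h2 ▸ huv⟩
  have hfind := Nat.find_spec hex
  have hmin : ∀ j < Nat.find hex, ¬ G.Adj v (c j) := fun j hj => Nat.find_min hex hj
  have hle : Nat.find hex ≤ n + 1 := Nat.find_min' hex (h2 ▸ huv)
  generalize Nat.find hex = i at hfind hmin hle
  have hne : ∀ j ≤ n, c j ≠ v := by
    rintro j hj rfl
    rcases Nat.eq_zero_or_pos j with rfl | hj0
    · exact hvx h1
    · exact hvI (h3 j hj0 hj)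
  have hPv : ∀ J : Set V, (∀ j, 0 < j → j ≤ i → c j ∈ J) → Pth G x v J i := by
    intro J hJ
    refine ⟨fun j => if j ≤ i then c j else v, by simp [h1], by simp, ?_, ?_⟩
    · intro j hj hji
      simp only [hji, if_true]
      exact hJ j hj hji
    · intro j k hjk hk
      have hji : j ≤ i := by omega
      simp only [hji, if_true]
      split_ifs with hki
      · exact h4 j k hjk (by omega)
      · refine ⟨?_, ?_⟩
        · by_cases hjn : j ≤ n
          · exact hne j hjn
          · obtain rfl : j = n + 1 := by omega
            rw [h2]
            exact huv.ne'
        · constructor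
          · intro hadj
            by_contra hcon
            exact hmin j (by omega) hadj.symm
          · intro hkj
            obtain rfl : j = i := by omega
            exact hfind.symm
  rcases Nat.lt_or_ge n i with hni | hni
  · obtain rfl : i = n + 1 := by omega
    refine Or.inl (hPv _ fun j hj hji => ?_)
    rcases Nat.lt_or_ge n j with h | h
    · obtain rfl : j = n + 1 := by omega
      exact Or.inl h2
    · exact Or.inr (h3 j hj h)
  · have hv : Pth G x v I i := hPv I (fun j hj hji => h3 j hj (by omega))
    refine Or.inr ⟨i, hv, ?_⟩
    -- If the first neighbour of `v` comes before the last interior vertex, the shortcut to `v`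
    -- misses all neighbours of `u`, and `u` can be appended after `v`. Otherwise the last interior
    -- vertex is a common neighbour.
    rcases hni.lt_or_eq with hlt | rfl
    · right
      have hux : c 0 ≠ u ∧ ¬ G.Adj (c 0) u := by
        rw [← h2]
        obtain ⟨a1, a2⟩ := h4 0 (n + 1) (by omega) le_rfl
        exact ⟨a1, by rw [a2]; omega⟩
      rw [h1] at hux
      have hv' : Pth G x v {w | ∃ j ≤ i, 0 < j ∧ w = c j} i :=
        hPv _ fun j hj hji => ⟨j, hji, hj, rfl⟩
      refine (hv'.snoc huv.symm ⟨hux.1, fun h => hux.2 h.symm⟩ ?_).mono ?_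
      · rintro _ ⟨j, hji, hj, rfl⟩
        rw [← h2]
        obtain ⟨a1, a2⟩ := h4 j (n + 1) (by omega) le_rfl
        refine ⟨a1, ?_⟩
        rw [adj_comm, a2]
        omega
      · rintro _ (rfl | ⟨j, hji, hj, rfl⟩)
        · exact Or.inl rfl
        · exact Or.inr (h3 j hj (by omega))
    · left
      exact ⟨c i, by rw [← h2]; exact (h4 i (i + 1) (by omega) le_rfl).2.2 rfl, hfind.symm⟩

theorem ConnOn.exists_pth {U : Set V} (hU : ConnOn G U) {x e : V} (hx : ∃ u ∈ U, G.Adj x u)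
    (he : ∃ u ∈ U, G.Adj e u) (hxU : x ∉ U) (heU : e ∉ U) (hxe : e ≠ x) :
    ∃ n, Pth G x e U n := by
  have hall : U ⊆ {u | u ∈ U ∧ ∃ n, Pth G x u U n} := by
    obtain ⟨u, hu, hxu⟩ := hx
    refine hU _ (fun u hu => hu.1) ⟨u, hu, 0, pth_of_adj U hxu⟩ ?_
    rintro a ⟨ha, n, hn⟩ q hq haq
    refine ⟨hq, ?_⟩
    have hqx : q ≠ x := fun h => hxU (h ▸ hq)
    by_cases hqp : ∃ J ⊆ U, q ∉ J ∧ Pth G x a J n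
    · obtain ⟨J, hJ, hqJ, hP⟩ := hqp
      rcases hP.extend haq.symm hqx hqJ with h | ⟨i, h, -⟩
      · exact ⟨_, h.mono (Set.insert_subset ha hJ)⟩
      · exact ⟨_, h.mono hJ⟩
    · obtain ⟨c, h1, h2, h3, h4⟩ := hn
      have : ∃ i, 0 < i ∧ i ≤ n ∧ c i = q := by
        by_contra! hcon
        refine hqp ⟨{v | v ∈ U ∧ v ≠ q}, fun v hv => hv.1, fun h => h.2 rfl, c, h1, h2,
          fun i hi hin => ⟨h3 i hi hin, hcon i hi hin⟩, h4⟩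
      obtain ⟨i, hi, hin, hq⟩ := this
      refine ⟨i - 1, Pth.truncate h1 h3 h4 (by omega) ?_⟩
      rw [← hq]
      congr 1
      omega
  obtain ⟨u, hu, heu⟩ := he
  obtain ⟨-, n, hn⟩ := hall hu
  rcases hn.extend heu hxe heU with h | ⟨i, h, -⟩
  · exact ⟨_, h.mono (Set.insert_subset hu subset_rfl)⟩
  · exact ⟨_, h⟩

/-! ### Pentagons -/

/-- `c` traverses an induced pentagon. -/
structure Pent (G : SimpleGraph V) (a b c d e : V) : Prop where
  ab : G.Adj a b
  bc : G.Adj b c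
  cd : G.Adj c d
  de : G.Adj d e
  ea : G.Adj e a
  ac : ¬ G.Adj a c
  bd : ¬ G.Adj b d
  ce : ¬ G.Adj c e
  da : ¬ G.Adj d a
  eb : ¬ G.Adj e b

theorem Pent.rot {a b c d e : V} (h : Pent G a b c d e) : Pent G b c d e a :=
  ⟨h.bc, h.cd, h.de, h.ea, h.ab, h.bd, h.ce, h.da, h.eb, h.ac⟩

theorem Pent.refl {a b c d e : V} (h : Pent G a b c d e) : Pent G a e d c b :=
  ⟨h.ea.symm, h.de.symm, h.cd.symm, h.bc.symm, h.ab.symm, fun k => h.da k.symm,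
    fun k => h.ce k.symm, fun k => h.bd k.symm, fun k => h.ac k.symm, fun k => h.eb k.symm⟩

/-- Take a shortest odd closed walk. Two of its vertices split it into arcs of opposite parity, so a
repeated vertex or a chord would give a shorter odd closed walk. It therefore traverses an induced
odd cycle. -/
theorem exists_pent_of_not_colorable (hG : ∀ n, Odd n → HasInducedCycle G n → n = 5)
    (h : ¬ G.Colorable 2) : ∃ a b c d e, Pent G a b c d e := by
  classical
  rw [two_colorable_iff_forall_loop_even] at h
  push Not at h
  have hex : ∃ n, Odd n ∧ ∃ (u : V) (w : G.Walk u u), w.length = n := by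
    obtain ⟨u, w, hw⟩ := h
    exact ⟨w.length, by simpa using hw, u, w, rfl⟩
  obtain ⟨hodd, u, w, hw⟩ := Nat.find_spec hex
  have hmin : ∀ m, Odd m → (∃ (u : V) (w : G.Walk u u), w.length = m) → Nat.find hex ≤ m :=
    fun m hm hw => Nat.find_min' hex ⟨hm, hw⟩
  generalize Nat.find hex = n at hodd hw hmin
  have hsub : ∀ i j, i ≤ j → j ≤ n → ∃ p : G.Walk (w.getVert i) (w.getVert j), p.length = j - i := by
    intro i j hij hj
    induction j, hij using Nat.le_induction with
    | base => exact ⟨Walk.nil, by simp⟩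
    | succ k hk ih =>
      obtain ⟨p, hp⟩ := ih (by omega)
      refine ⟨p.concat (w.adj_getVert_succ (by omega)), ?_⟩
      rw [Walk.length_concat, hp]
      omega
  have h0 : w.getVert 0 = u := w.getVert_zero
  have hnn : w.getVert n = u := by rw [← hw]; exact w.getVert_length
  have hout : ∀ i j, i < j → j < n →
      ∃ p : G.Walk (w.getVert j) (w.getVert i), p.length = n - (j - i) := by
    intro i j hij hj
    obtain ⟨p, hp⟩ := hsub j n hj.le le_rfl
    obtain ⟨q, hq⟩ := hsub 0 i (by omega) (by omega)
    exact ⟨(p.copy rfl (hnn.trans h0.symm)).append q, by simp [hp, hq]; omega⟩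
  have hn1 : n ≠ 1 := by
    rintro rfl
    have := w.adj_getVert_succ (i := 0) (by omega)
    rw [h0, zero_add, hnn] at this
    exact this.ne rfl
  have hcyc : ∀ i j, i < j → j < n → w.getVert i ≠ w.getVert j ∧
      (G.Adj (w.getVert i) (w.getVert j) ↔ j = i + 1 ∨ i + n = j + 1) := by
    intro i j hij hj
    obtain ⟨p, hp⟩ := hsub i j hij.le hj.le
    obtain ⟨q, hq⟩ := hout i j hij hj
    rw [Nat.odd_iff] at hodd
    refine ⟨fun he => ?_, fun hadj => ?_, ?_⟩
    · have k1 := hmin (p.copy rfl he.symm).length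
      have k2 := hmin (q.copy rfl he).length
      simp only [Walk.length_copy, hp, hq, Nat.odd_iff] at k1 k2
      have := fun h => k1 h ⟨_, p.copy rfl he.symm, by simp [hp]⟩
      have := fun h => k2 h ⟨_, q.copy rfl he, by simp [hq]⟩
      omega
    · have k1 := fun h => hmin (p.concat hadj.symm).length h ⟨_, _, rfl⟩
      have k2 := fun h => hmin (q.concat hadj).length h ⟨_, _, rfl⟩
      simp only [Walk.length_concat, hp, hq, Nat.odd_iff] at k1 k2
      omega
    · rintro (rfl | h)
      · exact w.adj_getVert_succ (by omega)
      · have := w.adj_getVert_succ (i := j) (by omega)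
        obtain rfl : i = 0 := by omega
        rw [show j + 1 = n by omega, hnn] at this
        rw [h0]
        exact this.symm
  have h3 : 3 ≤ n := by
    rw [Nat.odd_iff] at hodd
    omega
  obtain rfl := hG n hodd (hasInducedCycle_of_fun h3 w.getVert hcyc)
  refine ⟨w.getVert 0, w.getVert 1, w.getVert 2, w.getVert 3, w.getVert 4, ?_⟩
  have k : ∀ i j, i < j → j < 5 → (G.Adj (w.getVert i) (w.getVert j) ↔ j = i + 1 ∨ i + 5 = j + 1) :=
    fun i j hi hj => (hcyc i j hi hj).2
  constructor
  · rw [k _ _ (by omega) (by omega)]; omega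
  · rw [k _ _ (by omega) (by omega)]; omega
  · rw [k _ _ (by omega) (by omega)]; omega
  · rw [k _ _ (by omega) (by omega)]; omega
  · rw [adj_comm, k _ _ (by omega) (by omega)]; omega
  · rw [k _ _ (by omega) (by omega)]; omega
  · rw [k _ _ (by omega) (by omega)]; omega
  · rw [k _ _ (by omega) (by omega)]; omega
  · rw [adj_comm, k _ _ (by omega) (by omega)]; omega
  · rw [adj_comm, k _ _ (by omega) (by omega)]; omega

theorem hasInducedCycle_of_induce {S : Set V} {n : ℕ} (h : HasInducedCycle (G.induce S) n) :
    HasInducedCycle G n :=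
  ⟨h.1, h.2.trans ⟨Embedding.induce S⟩⟩

theorem Pentagonal.induce (hG : Pentagonal G) (S : Set V) : Pentagonal (G.induce S) :=
  fun n hn h => hG n hn (hasInducedCycle_of_induce h)

/-- A set of vertices of a pentagonal graph which contains no pentagon is bipartite. -/
theorem Pentagonal.colOn_two (hG : Pentagonal G) {S : Set V}
    (h : ∀ a ∈ S, ∀ b ∈ S, ∀ c ∈ S, ∀ d ∈ S, ∀ e ∈ S, ¬ Pent G a b c d e) : ColOn G S 2 := by
  rw [colOn_iff_induce, colOn_univ_iff]
  by_contra hc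
  obtain ⟨a, b, c, d, e, hp⟩ := exists_pent_of_not_colorable (hG.induce S) hc
  exact h a a.2 b b.2 c c.2 d d.2 e e.2
    ⟨hp.ab, hp.bc, hp.cd, hp.de, hp.ea, hp.ac, hp.bd, hp.ce, hp.da, hp.eb⟩

theorem Pentagonal.sep (hG : Pentagonal G) {a b c : V} (hab : G.Adj a b) (hac : G.Adj a c)
    (h : c ≠ b) : Sep G b c :=
  ⟨h, fun hbc => hG.not_triangle hab hbc hac⟩

/-- An induced path to a common neighbour of `c₀`, attached to the pentagon at `c₀`, `c₂`. -/
theorem Pent.no_path_two (hG : Pentagonal G) {c₀ c₁ c₂ c₃ c₄ x b : V} {J : Set V} {N : ℕ}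
    (hp : Pent G c₀ c₁ c₂ c₃ c₄) (h0 : G.Adj c₀ x) (h2 : G.Adj c₂ x)
    (hb : G.Adj c₃ b) (hP : Pth G x b J N) (hN : 3 ≤ N) (h3x : c₃ ≠ x) (h4x : c₄ ≠ x)
    (hb0 : b ≠ c₀) (hb2 : b ≠ c₂) (hb4 : b ≠ c₄)
    (f0 : Far G c₀ J) (f2 : Far G c₂ J) (f3 : Far G c₃ J) (f4 : Far G c₄ J) : False := by
  have s3 : Sep G x c₃ := hG.sep h2 hp.cd h3x
  have s4 : Sep G x c₄ := hG.sep h0 hp.ea.symm h4x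
  have b2 : Sep G c₂ b := hG.sep hp.cd.symm hb hb2
  have b4 : Sep G c₄ b := hG.sep hp.de hb hb4
  have q3 := hP.snoc hb s3.symm f3
  -- This cycle has length `N + 4`. The ones closed at `c₀`, directly from `b` or by way of `c₃,
  -- c₄`, have length `N + 3` or `N + 5`. All exceed five.
  have k1 := q3.close hG h2 hp.cd (f2.insert b2)
  by_cases hb0' : G.Adj c₀ b
  · have := hP.close hG h0 hb0' f0
    omega
  · have q4 := q3.snoc hp.de.symm s4.symm (f4.insert b4)
    have := q4.close hG h0 hp.ea.symm ((f0.insert ⟨hb0, hb0'⟩).insert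
      ⟨fun h => hp.bd.elim (h ▸ hp.ab.symm), fun h => hp.da h.symm⟩)
    omega

theorem Pent.sep_ac {a b c d e : V} (hp : Pent G a b c d e) : Sep G a c :=
  ⟨fun h => hp.da (h ▸ hp.cd.symm), hp.ac⟩

/-- If `c₀` missed `b`, the path could return to `c₀` by `c₂, c₁`, and also by `c₄` alone or by `c₂,
c₃, c₄`. The first return differs in parity from both others. -/
theorem Pent.adj_of_path (hG : Pentagonal G) {c₀ c₁ c₂ c₃ c₄ x b : V} {J : Set V} {N : ℕ}
    (hp : Pent G c₀ c₁ c₂ c₃ c₄) (h0 : G.Adj c₀ x) (s1 : Sep G c₁ x) (s2 : Sep G c₂ x)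
    (s3 : Sep G c₃ x) (s4 : Sep G c₄ x)
    (hb : G.Adj c₂ b) (hP : Pth G x b J N) (hN : 3 ≤ N)
    (hb0 : b ≠ c₀) (hb1 : b ≠ c₁) (hb3 : b ≠ c₃) (hb4 : b ≠ c₄)
    (f0 : Far G c₀ J) (f1 : Far G c₁ J) (f2 : Far G c₂ J) (f3 : Far G c₃ J) (f4 : Far G c₄ J) :
    G.Adj c₀ b := by
  by_contra hn
  have b0 : Sep G c₀ b := ⟨hb0, hn⟩
  have b1 : Sep G c₁ b := hG.sep hp.bc.symm hb hb1
  have b3 : Sep G c₃ b := hG.sep hp.cd hb hb3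
  have q2 := hP.snoc hb s2 f2
  have q1 := q2.snoc hp.bc s1 (f1.insert b1)
  have k1 := q1.close hG h0 hp.ab ((f0.insert b0).insert hp.sep_ac)
  by_cases h4 : G.Adj c₄ b
  · have q4 := hP.snoc h4 s4 f4
    have := q4.close hG h0 hp.ea.symm (f0.insert b0)
    omega
  · have b4 : Sep G c₄ b := ⟨hb4, h4⟩
    have q3 := q2.snoc hp.cd.symm s3 (f3.insert b3)
    have q4 := q3.snoc hp.de.symm s4 ((f4.insert b4).insert hp.rot.rot.sep_ac.symm)
    have := q4.close hG h0 hp.ea.symm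
      (((f0.insert b0).insert hp.sep_ac).insert hp.rot.rot.rot.sep_ac.symm)
    omega

/-! ### Levellings, parent choices and parity arguments -/

/-- Consecutive parts of a levelling: `C` attaches to `A`, which attaches to `Y`, which attaches
to the connected set `K`. -/
structure Layers (G : SimpleGraph V) (K Y A C : Set V) : Prop where
  conn : ConnOn G K
  yk : ∀ y ∈ Y, ∃ k ∈ K, G.Adj y k
  ay : ∀ a ∈ A, ∃ y ∈ Y, G.Adj a y
  ca : ∀ c ∈ C, ∃ a ∈ A, G.Adj c a
  disj_yk : ∀ y ∈ Y, y ∉ K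
  disj_ay : ∀ a ∈ A, a ∉ Y
  disj_ac : ∀ a ∈ A, a ∉ C
  far_ak : ∀ a ∈ A, Far G a K
  far_ck : ∀ c ∈ C, Far G c K
  far_cy : ∀ c ∈ C, Far G c Y

/-- `A` is ranked by the size of `S a`, and `b` picks a parent of least rank. All parents of a later
vertex then rank above `b u`, so their sets are at least as large as `S (b u)`, and an inclusion in
it must be an equality. -/
theorem exists_index [Finite V] {A C : Set V} (S : V → Set V) (hCA : ∀ c ∈ C, ∃ a ∈ A, G.Adj c a) :
    ∃ (b : V → V) (idx : V → ℕ), (∀ c ∈ C, b c ∈ A ∧ G.Adj c (b c)) ∧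
      (∀ u ∈ C, ∀ v ∈ C, idx u = idx v → b u = b v) ∧
      ∀ u ∈ C, ∀ x ∈ C, idx u < idx x → ∀ a ∈ A, G.Adj x a →
        a ≠ b u ∧ (S a ⊆ S (b u) → S (b u) ⊆ S a) := by
  classical
  obtain ⟨n, ⟨e⟩⟩ := Finite.exists_equiv_fin V
  -- Lexicographic rank: since `e a < n`, the enumeration only breaks ties, and it makes `r`
  -- injective.
  let r : V → ℕ := fun a => (S a).ncard * n + e a
  have hr : ∀ a b, (S a).ncard < (S b).ncard → r a < r b := by
    intro a b h
    have h1 : ((S a).ncard + 1) * n ≤ (S b).ncard * n := Nat.mul_le_mul_right n h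
    have := (e a).2
    simp only [r]
    rw [Nat.add_mul] at h1
    omega
  have hinj : ∀ a b, r a = r b → a = b := by
    intro a b h
    have h1 : ∀ a, r a % n = e a := fun a => by
      simp only [r]
      rw [Nat.mul_add_mod_self_right]
      exact Nat.mod_eq_of_lt (e a).2
    have := h1 a
    rw [h, h1 b] at this
    exact e.injective (Fin.ext this.symm)
  have hb : ∀ c, ∃ a, c ∈ C → (a ∈ A ∧ G.Adj c a) ∧ ∀ a' ∈ A, G.Adj c a' → r a ≤ r a' := by
    intro c
    by_cases hc : c ∈ C
    · obtain ⟨a, ha, hmin⟩ := Set.exists_min_image {a | a ∈ A ∧ G.Adj c a} r (Set.toFinite _)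
        (by obtain ⟨a, ha, h⟩ := hCA c hc; exact ⟨a, ha, h⟩)
      exact ⟨a, fun _ => ⟨ha, fun a' h1 h2 => hmin a' ⟨h1, h2⟩⟩⟩
    · exact ⟨c, fun h => (hc h).elim⟩
  choose b hb using hb
  refine ⟨b, fun c => r (b c), fun c hc => (hb c hc).1, fun u _ v _ h => hinj _ _ h, ?_⟩
  intro u hu x hx hux a ha hxa
  have hlt : r (b u) < r a := hux.trans_le ((hb x hx).2 a ha hxa)
  refine ⟨by rintro rfl; exact lt_irrefl _ hlt, fun hsub => ?_⟩
  have hle : (S (b u)).ncard ≤ (S a).ncard := by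
    by_contra h
    exact absurd (hr _ _ (not_le.1 h)) (by omega)
  exact (Set.eq_of_subset_of_ncard_le hsub hle (Set.toFinite _)).symm.subset

/-- The vertices at distance two from `v`. -/
def N2 (G : SimpleGraph V) (v : V) : Set V := {x | x ≠ v ∧ ¬ G.Adj v x ∧ ∃ w, G.Adj v w ∧ G.Adj w x}

/-- Supplies far vertices: by `sep_of_notMem_N2`, a neighbour of such a vertex is usually separated
from each member of `L` as well. -/
theorem exists_notMem_N2 {X : Set V} {t : ℕ} (hN : ∀ v, ColOn G (N2 G v) t) (L : List V)
    (hX : ¬ ColOn G X (L.length * t)) : ∃ x ∈ X, ∀ w ∈ L, x ∉ N2 G w := by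
  by_contra! hc
  apply hX
  clear hX
  have : ∀ L : List V, ColOn G {x | ∃ w ∈ L, x ∈ N2 G w} (L.length * t) := by
    intro L
    induction L with
    | nil => exact (colOn_empty _).mono (by rintro x ⟨w, hw, -⟩; simp at hw) le_rfl
    | cons a L ih =>
      refine ih.cover (hN a) ?_ (by rw [List.length_cons, Nat.add_mul, Nat.one_mul])
      rintro x ⟨w, hw, hx⟩
      rcases List.mem_cons.1 hw with rfl | hw
      · exact Or.inr hx
      · exact Or.inl ⟨w, hw, hx⟩
  exact (this L).mono hc le_rfl

theorem sep_of_notMem_N2 {x v w : V} (h : x ∉ N2 G w) (hxw : Sep G w x) (hxv : G.Adj x v)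
    (hvw : v ≠ w) : Sep G w v :=
  ⟨hvw, fun k => h ⟨hxw.1, hxw.2, v, k, hxv.symm⟩⟩

section
variable {K Y A C X₁ : Set V}

theorem Layers.sep_ca (hG : Pentagonal G) (hL : Layers G K Y A C) {u v b : V} (hv : v ∈ C)
    (hb : b ∈ A) (huv : G.Adj u v) (hub : G.Adj u b) : Sep G v b :=
  hG.sep huv hub (fun h => hL.disj_ac b hb (h ▸ hv))

theorem Layers.exists_pth_exit (hL : Layers G K Y A C) (hX : ConnOn G X₁) (hXC : X₁ ⊆ C)
    {x q s v : V} (hx : x ∈ C) (hxX : x ∉ X₁) (hq : q ∈ X₁) (hxq : G.Adj x q)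
    (hs : s ∈ X₁) (hsv : G.Adj s v) (hv : v ∈ A) : ∃ n, Pth G x v X₁ n :=
  hX.exists_pth ⟨q, hq, hxq⟩ ⟨s, hs, hsv.symm⟩ hxX (fun h => hL.disj_ac v hv (hXC h))
    (fun h => hL.disj_ac v hv (h ▸ hx))

/-- An edge `uv`, parents `bu`, `bv` with a common neighbour in `Y`, and an exit at `u`. -/
theorem Layers.no_exit_edge (hG : Pentagonal G) (hL : Layers G K Y A C) {u v bu bv y x v' y'' : V}
    {n : ℕ} (hu : u ∈ C) (hv : v ∈ C) (huv : G.Adj u v) (hbu : bu ∈ A) (hbv : bv ∈ A)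
    (hubu : G.Adj u bu) (hvbv : G.Adj v bv) (hy : y ∈ Y) (hyu : G.Adj bu y) (hyv : G.Adj bv y)
    (hXC : X₁ ⊆ C) (hx : x ∈ C) (hux : G.Adj u x) (hvx : v ≠ x)
    (fu : Far G u X₁) (fv : Far G v X₁) (fbu : Far G bu X₁) (fbv : Far G bv X₁)
    (sbu : Sep G bu x) (sbv : Sep G bv x) (hv' : v' ∈ A) (hP : Pth G x v' X₁ n)
    (hy'' : y'' ∈ Y) (hvy : G.Adj v' y'') (hbuy : ¬ G.Adj bu y'')
    (s1 : Sep G y v') (s2 : Sep G bu v') (s3 : Sep G bv v') (s4 : Sep G u v') (s5 : Sep G v v') :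
    False := by
  have svx : Sep G v x := (hG.sep hux huv hvx).symm
  have subv : Sep G u bv := hL.sep_ca hG hu hbv huv.symm hvbv
  have sbuv : Sep G v bu := hL.sep_ca hG hv hbu huv hubu
  have hyy : y'' ≠ y := fun h => hbuy (h ▸ hyu)
  have fyX : ∀ y ∈ Y, Far G y X₁ := fun y hy x hx => (hL.far_cy x (hXC hx) y hy).symm
  have fy : ∀ y ∈ Y, Sep G y x := fun y hy => (hL.far_cy x hx y hy).symm
  have sY : ∀ y ∈ Y, ∀ c ∈ C, Sep G c y := fun y hy c hc => hL.far_cy c hc y hy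
  have sbb : Sep G bu bv := hG.sep hyu.symm hyv.symm (by
    rintro rfl
    exact subv.2 hubu)
  have sbuy : Sep G bu y'' := ⟨fun h => hL.disj_ay _ hbu (h ▸ hy''), hbuy⟩
  -- If `bv` sees `y''`, the returns to `u` by `bv, v` and by `bv, y, bu` differ in length by one.
  by_cases hbvy : G.Adj bv y''
  · have q1 := hP.snoc hvy.symm (fy _ hy'') (fyX _ hy'')
    have q2 := q1.snoc hbvy sbv (fbv.insert s3)
    have q3 := q2.snoc hvbv svx ((fv.insert s5).insert (sY _ hy'' _ hv))
    have k1 := q3.close hG hux huv (((fu.insert s4).insert (sY _ hy'' _ hu)).insert subv)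
    have r3 := q2.snoc hyv.symm (fy _ hy)
      (((fyX _ hy).insert s1).insert (hG.sep hyv hbvy hyy))
    have r4 := r3.snoc hyu sbu (((fbu.insert s2).insert sbuy).insert sbb)
    have k2 := r4.close hG hux hubu
      ((((fu.insert s4).insert (sY _ hy'' _ hu)).insert subv).insert (sY _ hy _ hu))
    omega
  · have sbvy : Sep G bv y'' := ⟨fun h => hL.disj_ay _ hbv (h ▸ hy''), hbvy⟩
    -- Neither parent sees `y''`, so the path can run on from `v'` through `y''` and `K` to `y`.
    -- From `y` the returns by `bu` and by `bv, v` differ in length by one.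
    obtain ⟨k, hk, hyk⟩ := hL.yk y'' hy''
    obtain ⟨k', hk', hyk'⟩ := hL.yk y hy
    obtain ⟨m, hm⟩ := (hL.conn.insert hk hyk).exists_pth (x := v') (e := y)
      ⟨y'', Or.inl rfl, hvy⟩ ⟨k', Or.inr hk', hyk'⟩
      (by
        rintro (h | h)
        · exact hL.disj_ay v' hv' (h ▸ hy'')
        · exact (hL.far_ak v' hv' v' h).1 rfl)
      (by
        rintro (h | h)
        · exact hyy h.symm
        · exact hL.disj_yk y hy h) s1.1.symm
    have hm0 : m ≠ 0 := by
      rintro rfl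
      exact s1.2 hm.adj.symm
    have fC : ∀ c ∈ C, Far G c (insert y'' K) := fun c hc => (hL.far_ck c hc).insert (sY _ hy'' c hc)
    have q := hP.join hm (sY _ hy _ hx) (fC x hx) (fyX y hy) (fun c hc => fC c (hXC hc))
    have q1 := q.snoc hyu sbu ((fbu.union ((hL.far_ak bu hbu).insert sbuy)).insert s2)
    have k1 := q1.close hG hux hubu (((fu.union (fC u hu)).insert s4).insert (sY _ hy _ hu))
    have r1 := q.snoc hyv sbv ((fbv.union ((hL.far_ak bv hbv).insert sbvy)).insert s3)
    have r2 := r1.snoc hvbv svx (((fv.union (fC v hv)).insert s5).insert (sY _ hy _ hv))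
    have k2 := r2.close hG hux huv
      ((((fu.union (fC u hu)).insert s4).insert (sY _ hy _ hu)).insert subv)
    omega

/-- The final step for a pentagon whose exit is attached at `c` only. -/
theorem Layers.no_fork (hG : Pentagonal G) (hL : Layers G K Y A C) {c b b' p q x v' : V}
    {U : Set V} {n m : ℕ} (hc : c ∈ C) (hb' : b' ∈ A) (hcb : G.Adj c b)
    (hcb' : G.Adj c b') (hp : p ∈ Y) (hq : q ∈ Y) (hbp : G.Adj b p) (hbq : G.Adj b' q)
    (hb'p : ¬ G.Adj b' p) (hUY : U ⊆ K ∪ Y) (hXC : X₁ ⊆ C) (hx : x ∈ C) (hcx : G.Adj c x)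
    (fc : Far G c X₁) (fb : Far G b X₁) (fb' : Far G b' X₁) (sb : Sep G b x) (sb' : Sep G b' x)
    (fU : Far G b U) (fU' : Far G b' U) (hP : Pth G x v' X₁ n) (hn : n ≠ 0)
    (s1 : Sep G c v') (s2 : Sep G b v') (s3 : Sep G b' v')
    (hm : Pth G v' p U m) (hm' : Pth G v' q (insert p U) (m + 1)) : False := by
  have fC : ∀ c ∈ C, Far G c U := fun c hc v hv => by
    rcases hUY hv with h | h
    · exact hL.far_ck c hc v h
    · exact hL.far_cy c hc v h
  have sY : ∀ y ∈ Y, ∀ c ∈ C, Sep G c y := fun y hy c hc => hL.far_cy c hc y hy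
  have fyX : ∀ y ∈ Y, Far G y X₁ := fun y hy x hx => (hL.far_cy x (hXC hx) y hy).symm
  -- The return to `c` by `p, b` is one shorter than the return by `q, b'`; `n ≠ 0` makes both
  -- cycles longer than five.
  have q1 := hP.join hm (sY p hp x hx) (fC x hx) (fyX p hp) (fun c hc => fC c (hXC hc))
  have q2 := q1.snoc hbp sb ((fb.union fU).insert s2)
  have k1 := q2.close hG hcx hcb (((fc.union (fC c hc)).insert s1).insert (sY p hp c hc))
  have r1 := hP.join hm' (sY q hq x hx) ((fC x hx).insert (sY p hp x hx)) (fyX q hq)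
    (fun c hc => (fC c (hXC hc)).insert (sY p hp c (hXC hc)))
  have sbp : Sep G b' p := ⟨fun h => hL.disj_ay _ hb' (h ▸ hp), hb'p⟩
  have r2 := r1.snoc hbq sb' ((fb'.union (fU'.insert sbp)).insert s3)
  have k2 := r2.close hG hcx hcb'
    (((fc.union ((fC c hc).insert (sY p hp c hc))).insert s1).insert (sY q hq c hc))
  omega

end

/-! ### Active vertices and the exclusion of active pentagons -/

/-- A levelling together with a choice `b c ∈ A` of a parent of each `c ∈ C` and a numbering of `C`
which is compatible with this choice. -/
structure Indexed (G : SimpleGraph V) (K Y A C : Set V) (b : V → V) (idx : V → ℕ) : Prop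
    extends Layers G K Y A C where
  mem : ∀ c ∈ C, b c ∈ A
  adj : ∀ c ∈ C, G.Adj c (b c)
  sep : ∀ u ∈ C, ∀ x ∈ C, idx u < idx x → Sep G (b u) x
  not_sub : ∀ u ∈ C, ∀ x ∈ C, idx u < idx x → ∀ a ∈ A, G.Adj x a → ∀ y ∈ Y, G.Adj (b u) y →
    ¬ G.Adj a y → ∃ y' ∈ Y, G.Adj a y' ∧ ¬ G.Adj (b u) y'

/-- The vertex `v` is attached to a connected set of later vertices
which is not `c`-colourable. -/
def Active (G : SimpleGraph V) (C : Set V) (idx : V → ℕ) (c : ℕ) (v : V) : Prop :=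
  ∃ X ⊆ C, ConnOn G X ∧ (∀ x ∈ X, idx v < idx x) ∧ (∃ x ∈ X, G.Adj v x) ∧ ¬ ColOn G X c

theorem Pentagonal.colOn_neighbors (hG : Pentagonal G) (L : List V) (X : Set V) :
    ColOn G (X ∩ {x | ∃ w ∈ L, G.Adj w x}) L.length := by
  induction L with
  | nil => exact (colOn_empty _).mono (by rintro x ⟨-, w, hw, -⟩; simp at hw) le_rfl
  | cons a L ih =>
    refine ih.cover (T := {x | G.Adj a x}) (n := 1) (colOn_one_of_stable fun u hu v hv huv =>
      hG.not_triangle hu huv hv) ?_ le_rfl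
    rintro x ⟨hx, w, hw, hwx⟩
    rcases List.mem_cons.1 hw with rfl | hw
    · exact Or.inr hwx
    · exact Or.inl ⟨hx, w, hw, hwx⟩

section
variable {K Y A C X₁ : Set V} {b : V → V} {idx : V → ℕ} {t : ℕ}

/-- The set attached to the member of `L` of largest index is later than all of `L`. Neighbourhoods
are stable, so deleting those of `L` costs `L.length` colours, and the remaining component is
attached at some deleted `x`. -/
theorem exists_exit_of_active (hG : Pentagonal G) {m : ℕ} (L : List V) (hL : L ≠ [])
    (hact : ∀ w ∈ L, Active G C idx (m + L.length) w) :
    ∃ X₁ ⊆ C, ConnOn G X₁ ∧ ¬ ColOn G X₁ m ∧ (∀ w ∈ L, Far G w X₁) ∧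
      (∀ w ∈ L, ∀ x ∈ X₁, idx w < idx x) ∧
      ∃ x ∈ C, x ∉ X₁ ∧ (∀ w ∈ L, idx w < idx x) ∧ (∃ w ∈ L, G.Adj w x) ∧
        ∃ q ∈ X₁, G.Adj x q := by
  obtain ⟨w, hw, hmax⟩ := Set.exists_max_image {w | w ∈ L} idx (List.finite_toSet L)
    (List.exists_mem_of_ne_nil L hL)
  obtain ⟨X, hXC, hX, hlt, ⟨x₀, hx₀, hwx₀⟩, hcol⟩ := hact w hw
  have hlt' : ∀ w ∈ L, ∀ x ∈ X, idx w < idx x := fun w' hw' x hx => (hmax w' hw').trans_lt (hlt x hx)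
  obtain ⟨X₁, hsub, hX₁, hcol₁, x, ⟨hxX, hxN⟩, hq⟩ := hX.exists_exit (N := {x | ∃ w ∈ L, G.Adj w x})
    ⟨x₀, hx₀, w, hw, hwx₀⟩ hcol (hG.colOn_neighbors L X)
  refine ⟨X₁, fun x hx => hXC (hsub hx).1, hX₁, hcol₁, ?_,
    fun w hw x hx => hlt' w hw x (hsub hx).1, x, hXC hxX, fun h => (hsub h).2 hxN,
    fun w hw => hlt' w hw x hxX, hxN, hq⟩
  intro w hw x hx
  exact ⟨fun h => lt_irrefl _ (h ▸ hlt' w hw x (hsub hx).1), fun h => (hsub hx).2 ⟨w, hw, h⟩⟩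

theorem Active.mono {c c' : ℕ} {v : V} (h : Active G C idx c v) (hc : c' ≤ c) :
    Active G C idx c' v := by
  obtain ⟨X, h1, h2, h3, h4, h5⟩ := h
  exact ⟨X, h1, h2, h3, h4, fun k => h5 (k.mono subset_rfl hc)⟩

/-- The parents of adjacent active vertices have no common neighbour in `Y`. -/
theorem Indexed.no_active_edge (hG : Pentagonal G) (hI : Indexed G K Y A C b idx)
    (hN : ∀ v, ColOn G (N2 G v) t) {u v y : V} (hu : u ∈ C) (hv : v ∈ C)
    (hua : Active G C idx (5 * t + 2) u) (hva : Active G C idx (5 * t + 2) v) (huv : G.Adj u v)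
    (hy : y ∈ Y) (hyu : G.Adj (b u) y) (hyv : G.Adj (b v) y) : False := by
  have hL := hI.toLayers
  obtain ⟨X₁, hXC, hX, hcol, hfar, hlt, x, hxC, hxX, hxlt, hwx, q, hq, hxq⟩ :=
    exists_exit_of_active hG (m := 5 * t) [u, v] (by simp) (by simpa using ⟨hua, hva⟩)
  -- Five second neighbourhoods account for `5 * t`; the `2` was spent on the neighbourhoods of `u`
  -- and `v`.
  obtain ⟨s, hs, hsN⟩ := exists_notMem_N2 (X := X₁) hN [y, b u, b v, u, v] (by simpa using hcol)
  simp only [List.mem_cons, List.not_mem_nil, or_false, forall_eq_or_imp, forall_eq, exists_eq_or_imp,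
    exists_eq_left] at hfar hlt hxlt hwx hsN
  obtain ⟨n1, n2, n3, n4, n5⟩ := hsN
  have hsC := hXC hs
  have hv' := hI.mem s hsC
  have hsv' := hI.adj s hsC
  obtain ⟨n, hP⟩ := hL.exists_pth_exit hX hXC hxC hxX hq hxq hs hsv' hv'
  have hbu := hI.mem u hu
  have hbv := hI.mem v hv
  have fbu : Far G (b u) X₁ := fun x hx => hI.sep u hu x (hXC hx) (hlt.1 x hx)
  have fbv : Far G (b v) X₁ := fun x hx => hI.sep v hv x (hXC hx) (hlt.2 x hx)
  have sbu := hI.sep u hu x hxC hxlt.1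
  have sbv := hI.sep v hv x hxC hxlt.2
  have s1 : Sep G y (b s) := sep_of_notMem_N2 n1 (hL.far_cy s hsC y hy).symm hsv'
    (fun h => hL.disj_ay _ hv' (h ▸ hy))
  have s2 : Sep G (b u) (b s) := sep_of_notMem_N2 n2 (fbu s hs) hsv'
    (fun h => (fbu s hs).2 (h ▸ hsv'.symm))
  have s3 : Sep G (b v) (b s) := sep_of_notMem_N2 n3 (fbv s hs) hsv'
    (fun h => (fbv s hs).2 (h ▸ hsv'.symm))
  have s4 : Sep G u (b s) := sep_of_notMem_N2 n4 (hfar.1 s hs) hsv'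
    (fun h => hL.disj_ac _ hv' (h ▸ hu))
  have s5 : Sep G v (b s) := sep_of_notMem_N2 n5 (hfar.2 s hs) hsv'
    (fun h => hL.disj_ac _ hv' (h ▸ hv))
  rcases hwx with hux | hvx
  · obtain ⟨y', hy', h1, h2⟩ := hI.not_sub u hu s hsC (hlt.1 s hs) _ hv' hsv' y hy hyu
      (fun h => s1.2 h.symm)
    exact hL.no_exit_edge hG hu hv huv hbu hbv (hI.adj u hu) (hI.adj v hv) hy hyu hyv hXC hxC hux
      (fun h => lt_irrefl _ (h ▸ hxlt.2)) hfar.1 hfar.2 fbu fbv sbu sbv hv' hP hy' h1 h2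
      s1 s2 s3 s4 s5
  · obtain ⟨y', hy', h1, h2⟩ := hI.not_sub v hv s hsC (hlt.2 s hs) _ hv' hsv' y hy hyv
      (fun h => s1.2 h.symm)
    exact hL.no_exit_edge hG hv hu huv.symm hbv hbu (hI.adj v hv) (hI.adj u hu) hy hyv hyu hXC hxC
      hvx (fun h => lt_irrefl _ (h ▸ hxlt.1)) hfar.2 hfar.1 fbv fbu sbv sbu hv' hP hy' h1 h2
      s1 s3 s2 s5 s4

/-- A connected set `X₁` of large chromatic number, attached to a vertex `x`, which lies after all
vertices of `P` and has no neighbour in `P`. -/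
structure Probe (G : SimpleGraph V) (C : Set V) (idx : V → ℕ) (m : ℕ) (P X₁ : Set V) (x : V) :
    Prop where
  sub : X₁ ⊆ C
  conn : ConnOn G X₁
  col : ¬ ColOn G X₁ m
  far : ∀ w ∈ P, Far G w X₁
  lt : ∀ w ∈ P, ∀ x ∈ X₁, idx w < idx x
  mem : x ∈ C
  notMem : x ∉ X₁
  lt_x : ∀ w ∈ P, idx w < idx x
  adj : ∃ q ∈ X₁, G.Adj x q

variable {P : Set V} {x : V} {m : ℕ}

/-- `v'` is the parent of some `s ∈ X₁` outside eight second neighbourhoods: those of five vertices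
of `P`, two parents, and `x`. Avoiding the last one gives `n ≠ 0`: an edge from `x` to `v'` would
create a triangle with `s` or put `s` at distance two from `x`. -/
theorem Indexed.probe_parent (hG : Pentagonal G) (hI : Indexed G K Y A C b idx)
    (hN : ∀ v, ColOn G (N2 G v) t) (hX : Probe G C idx (8 * t) P X₁ x) (hPC : P ⊆ C)
    {c₀ c₁ c₂ c₃ c₄ d d' : V} (h0 : c₀ ∈ P) (h1 : c₁ ∈ P) (h2 : c₂ ∈ P) (h3 : c₃ ∈ P)
    (h4 : c₄ ∈ P) (hd : d ∈ P) (hd' : d' ∈ P) :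
    ∃ v' ∈ A, ∃ n, n ≠ 0 ∧ Pth G x v' X₁ n ∧ Sep G c₀ v' ∧ Sep G c₁ v' ∧ Sep G c₂ v' ∧
      Sep G c₃ v' ∧ Sep G c₄ v' ∧ Sep G (b d) v' ∧ Sep G (b d') v' := by
  have hL := hI.toLayers
  obtain ⟨s, hs, hsN⟩ := exists_notMem_N2 (X := X₁) hN [c₀, c₁, c₂, c₃, c₄, b d, b d', x]
    (by simpa using hX.col)
  simp only [List.mem_cons, List.not_mem_nil, or_false, forall_eq_or_imp, forall_eq] at hsN
  obtain ⟨n0, n1, n2, n3, n4, n5, n6, n7⟩ := hsN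
  have hsC := hX.sub hs
  have hv' := hI.mem s hsC
  have hsv' := hI.adj s hsC
  obtain ⟨q, hq, hxq⟩ := hX.adj
  obtain ⟨n, hP⟩ := hL.exists_pth_exit hX.conn hX.sub hX.mem hX.notMem hq hxq hs hsv' hv'
  have key : ∀ c ∈ P, s ∉ N2 G c → Sep G c (b s) := fun c hc hn =>
    sep_of_notMem_N2 hn (hX.far c hc s hs) hsv' (fun h => hL.disj_ac _ hv' (h ▸ hPC hc))
  have key' : ∀ c ∈ P, s ∉ N2 G (b c) → Sep G (b c) (b s) := fun c hc hn => by
    have hsep := hI.sep c (hPC hc) s hsC (hX.lt c hc s hs)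
    exact sep_of_notMem_N2 hn hsep hsv' (fun h => hsep.2 (h ▸ hsv'.symm))
  refine ⟨b s, hv', n, ?_, hP, key _ h0 n0, key _ h1 n1, key _ h2 n2, key _ h3 n3, key _ h4 n4,
    key' _ hd n5, key' _ hd' n6⟩
  rintro rfl
  by_cases hxs : G.Adj x s
  · exact hG.not_triangle hxs hsv' hP.adj
  · exact n7 ⟨fun h => hX.notMem (h ▸ hs), hxs, _, hP.adj, hsv'.symm⟩

theorem Layers.exists_path_to_parent (hL : Layers G K Y A C) {v' a : V} {n : ℕ} (hXC : X₁ ⊆ C)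
    (hx : x ∈ C) (hv' : v' ∈ A) (hP : Pth G x v' X₁ n) (hn : n ≠ 0) (ha : a ∈ A)
    (fa : Far G a X₁) (sa : Sep G a x) (s : Sep G a v') :
    ∃ N, 3 ≤ N ∧ Pth G x a (insert v' (X₁ ∪ (K ∪ Y))) N := by
  have hdis : ∀ a ∈ A, a ∉ K ∪ Y := by
    rintro a ha (h | h)
    · exact (hL.far_ak a ha a h).1 rfl
    · exact hL.disj_ay a ha h
  obtain ⟨y, hy, hvy⟩ := hL.ay v' hv'
  obtain ⟨y', hy', hay⟩ := hL.ay a ha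
  obtain ⟨m, hm⟩ := (hL.conn.union hL.yk).exists_pth ⟨y, Or.inr hy, hvy⟩ ⟨y', Or.inr hy', hay⟩
    (hdis v' hv') (hdis a ha) s.1.symm
  have hm0 : m ≠ 0 := by
    rintro rfl
    exact s.2 hm.adj.symm
  have fC : ∀ c ∈ C, Far G c (K ∪ Y) := fun c hc => (hL.far_ck c hc).union (hL.far_cy c hc)
  exact ⟨_, by omega, hP.join hm sa.symm (fC x hx) fa (fun c hc => fC c (hXC hc))⟩

theorem Indexed.no_probe_two (hG : Pentagonal G) (hI : Indexed G K Y A C b idx)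
    (hN : ∀ v, ColOn G (N2 G v) t) (hX : Probe G C idx (8 * t) P X₁ x) (hPC : P ⊆ C)
    {c₀ c₁ c₂ c₃ c₄ : V} (h0 : c₀ ∈ P) (h1 : c₁ ∈ P) (h2 : c₂ ∈ P) (h3 : c₃ ∈ P)
    (h4 : c₄ ∈ P) (hp : Pent G c₀ c₁ c₂ c₃ c₄) (h0x : G.Adj c₀ x) (h2x : G.Adj c₂ x) : False := by
  have hL := hI.toLayers
  obtain ⟨v', hv', n, hn, hP, s0, s1, s2, s3, s4, sb, -⟩ :=
    hI.probe_parent hG hN hX hPC h0 h1 h2 h3 h4 h3 h3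
  have hb := hI.mem c₃ (hPC h3)
  obtain ⟨N, h3N, hPN⟩ := hL.exists_path_to_parent hX.sub hX.mem hv' hP hn hb
    (fun x hx => hI.sep c₃ (hPC h3) x (hX.sub hx) (hX.lt c₃ h3 x hx))
    (hI.sep c₃ (hPC h3) x hX.mem (hX.lt_x c₃ h3)) sb
  have hne : ∀ c ∈ P, c ≠ x := fun c hc h => lt_irrefl _ (h ▸ hX.lt_x c hc)
  have hbne : ∀ c ∈ P, b c₃ ≠ c := fun c hc h => hL.disj_ac _ hb (h ▸ hPC hc)
  have hJ : ∀ c ∈ P, Sep G c v' → Far G c (insert v' (X₁ ∪ (K ∪ Y))) := fun c hc hs =>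
    ((hX.far c hc).union ((hL.far_ck c (hPC hc)).union (hL.far_cy c (hPC hc)))).insert hs
  exact hp.no_path_two hG h0x h2x (hI.adj c₃ (hPC h3)) hPN h3N (hne _ h3) (hne _ h4) (hbne _ h0)
    (hbne _ h2) (hbne _ h4) (hJ _ h0 s0) (hJ _ h2 s2) (hJ _ h3 s3) (hJ _ h4 s4)

/-- `Pent.adj_of_path`, used on both sides, makes `c₀` adjacent to the parents of `c₂` and `c₃`.
Their neighbourhoods in `Y` are disjoint by `hedge`, and complete to each other by parity. So a path
descending from `v'` reaches them with lengths differing by one, and `Layers.no_fork` applies. -/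
theorem Indexed.no_probe_one (hG : Pentagonal G) (hI : Indexed G K Y A C b idx)
    (hN : ∀ v, ColOn G (N2 G v) t) (hX : Probe G C idx (8 * t) P X₁ x) (hPC : P ⊆ C)
    (hedge : ∀ u ∈ P, ∀ v ∈ P, G.Adj u v → ∀ y ∈ Y, G.Adj (b u) y → G.Adj (b v) y → False)
    {c₀ c₁ c₂ c₃ c₄ : V} (h0 : c₀ ∈ P) (h1 : c₁ ∈ P) (h2 : c₂ ∈ P) (h3 : c₃ ∈ P)
    (h4 : c₄ ∈ P) (hp : Pent G c₀ c₁ c₂ c₃ c₄) (h0x : G.Adj c₀ x) (h2x : ¬ G.Adj c₂ x)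
    (h3x : ¬ G.Adj c₃ x) : False := by
  have hL := hI.toLayers
  obtain ⟨v', hv', n, hn, hP, s0, s1, s2, s3, s4, sb2, sb3⟩ :=
    hI.probe_parent hG hN hX hPC h0 h1 h2 h3 h4 h2 h3
  have hne : ∀ c ∈ P, c ≠ x := fun c hc h => lt_irrefl _ (h ▸ hX.lt_x c hc)
  have hbA : ∀ c ∈ P, b c ∈ A := fun c hc => hI.mem c (hPC hc)
  have hbadj : ∀ c ∈ P, G.Adj c (b c) := fun c hc => hI.adj c (hPC hc)
  have hbX : ∀ c ∈ P, Far G (b c) X₁ := fun c hc x hx =>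
    hI.sep c (hPC hc) x (hX.sub hx) (hX.lt c hc x hx)
  have hbx : ∀ c ∈ P, Sep G (b c) x := fun c hc => hI.sep c (hPC hc) x hX.mem (hX.lt_x c hc)
  have hbne : ∀ d ∈ P, ∀ c ∈ P, b d ≠ c := fun d hd c hc h =>
    hL.disj_ac _ (hbA d hd) (h ▸ hPC hc)
  have hJ : ∀ c ∈ P, Sep G c v' → Far G c (insert v' (X₁ ∪ (K ∪ Y))) := fun c hc hs =>
    ((hX.far c hc).union ((hL.far_ck c (hPC hc)).union (hL.far_cy c (hPC hc)))).insert hs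
  have x1 : Sep G c₁ x := (hG.sep h0x hp.ab (hne _ h1)).symm
  have x4 : Sep G c₄ x := (hG.sep h0x hp.ea.symm (hne _ h4)).symm
  have x2 : Sep G c₂ x := ⟨(hne _ h2).symm, h2x⟩
  have x3 : Sep G c₃ x := ⟨(hne _ h3).symm, h3x⟩
  have hpath : ∀ c ∈ P, Sep G (b c) v' →
      ∃ N, 3 ≤ N ∧ Pth G x (b c) (insert v' (X₁ ∪ (K ∪ Y))) N := fun c hc hs =>
    hL.exists_path_to_parent hX.sub hX.mem hv' hP hn (hbA c hc) (hbX c hc) (hbx c hc) hs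
  have h02 : G.Adj c₀ (b c₂) := by
    obtain ⟨N, h3N, hPN⟩ := hpath c₂ h2 sb2
    exact hp.adj_of_path hG h0x x1 x2 x3 x4 (hbadj _ h2) hPN h3N (hbne _ h2 _ h0) (hbne _ h2 _ h1)
      (hbne _ h2 _ h3) (hbne _ h2 _ h4) (hJ _ h0 s0) (hJ _ h1 s1) (hJ _ h2 s2) (hJ _ h3 s3)
      (hJ _ h4 s4)
  have h03 : G.Adj c₀ (b c₃) := by
    obtain ⟨N, h3N, hPN⟩ := hpath c₃ h3 sb3
    exact hp.refl.adj_of_path hG h0x x4 x3 x2 x1 (hbadj _ h3) hPN h3N (hbne _ h3 _ h0)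
      (hbne _ h3 _ h4) (hbne _ h3 _ h2) (hbne _ h3 _ h1) (hJ _ h0 s0) (hJ _ h4 s4) (hJ _ h3 s3)
      (hJ _ h2 s2) (hJ _ h1 s1)
  have hbb : b c₃ ≠ b c₂ := fun h => hG.not_triangle hp.cd (hbadj _ h3) (h ▸ hbadj _ h2)
  have sbb : Sep G (b c₂) (b c₃) := hG.sep h02 h03 hbb
  have e1 : ∀ y ∈ Y, G.Adj (b c₂) y → ¬ G.Adj (b c₃) y := fun y hy h h' =>
    hedge _ h2 _ h3 hp.cd y hy h h'
  have hAY : ∀ a ∈ A, ∀ y ∈ Y, ¬ G.Adj a y → Sep G a y := fun a ha y hy h =>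
    ⟨fun e => hL.disj_ay a ha (e ▸ hy), h⟩
  -- Otherwise the parents are joined through `K` by an induced path with at least three interior
  -- vertices, which closes through `c₀` and, one longer, through `c₃, c₂`.
  have hyy : ∀ y ∈ Y, ∀ y' ∈ Y, G.Adj (b c₂) y → G.Adj (b c₃) y' → G.Adj y y' := by
    intro y hy y' hy' hby hby'
    by_contra hn'
    obtain ⟨k, hk, hyk⟩ := hL.yk y hy
    obtain ⟨k', hk', hyk'⟩ := hL.yk y' hy'
    have hU := (hL.conn.insert hk hyk).insert (Or.inr hk') hyk'
    have hUK : ∀ a ∈ A, a ∉ insert y' (insert y K) := by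
      rintro a ha (h | h | h)
      · exact hL.disj_ay a ha (h ▸ hy')
      · exact hL.disj_ay a ha (h ▸ hy)
      · exact (hL.far_ak a ha a h).1 rfl
    obtain ⟨m, hm⟩ := hU.exists_pth ⟨y, Or.inr (Or.inl rfl), hby⟩ ⟨y', Or.inl rfl, hby'⟩
      (hUK _ (hbA _ h2)) (hUK _ (hbA _ h3)) hbb
    have m2 : ∀ v ∈ insert y' (insert y K), G.Adj (b c₂) v → v = y := by
      rintro v (rfl | rfl | h) hv
      · exact (e1 v hy' hv hby').elim
      · rfl
      · exact ((hL.far_ak _ (hbA _ h2) v h).2 hv).elim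
    have m3 : ∀ v ∈ insert y' (insert y K), G.Adj (b c₃) v → v = y' := by
      rintro v (rfl | rfl | h) hv
      · rfl
      · exact (e1 v hy hby hv).elim
      · exact ((hL.far_ak _ (hbA _ h3) v h).2 hv).elim
    have hm0 : m ≠ 0 := by
      rintro rfl
      exact sbb.2 hm.adj
    have hm1 : m ≠ 1 := by
      rintro rfl
      obtain ⟨v, hv, k1, k2⟩ := hm.common_nbr
      obtain rfl := m2 v hv k1
      exact e1 v hy hby k2.symm
    have hm2 : m ≠ 2 := by
      rintro rfl
      obtain ⟨v, hv, w, hw, k1, k2, k3⟩ := hm.two_nbrs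
      rw [m2 v hv k1, m3 w hw k3.symm] at k2
      exact hn' k2
    have fU : ∀ c ∈ C, Far G c (insert y' (insert y K)) := fun c hc =>
      ((hL.far_ck c hc).insert (hL.far_cy c hc y hy)).insert (hL.far_cy c hc y' hy')
    have k1 := hm.close hG h02 h03 (fU _ (hPC h0))
    have q := hm.snoc (hbadj _ h3)
      (hG.sep hp.cd (hbadj _ h2) (hbne _ h2 _ h3)) (fU _ (hPC h3))
    have k2 := q.close hG (hbadj _ h2) hp.cd ((fU _ (hPC h2)).insert
      (hG.sep hp.cd.symm (hbadj _ h3) (hbne _ h3 _ h2)))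
    omega
  have hfork : ∀ (p q : V) (U : Set V) (m : ℕ), p ∈ Y → q ∈ Y → U ⊆ K ∪ Y →
      Far G (b c₂) U → Far G (b c₃) U →
      (G.Adj (b c₂) p ∧ G.Adj (b c₃) q ∨ G.Adj (b c₃) p ∧ G.Adj (b c₂) q) →
      Pth G v' p U m → Pth G v' q (insert p U) (m + 1) → False := by
    rintro p q U m hp hq hU f2 f3 (⟨k1, k2⟩ | ⟨k1, k2⟩) hm hm'
    · exact hL.no_fork hG (hPC h0) (hbA _ h3) h02 h03 hp hq k1 k2 (e1 p hp k1) hU hX.sub hX.mem h0x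
        (hX.far _ h0) (hbX _ h2) (hbX _ h3) (hbx _ h2) (hbx _ h3) f2 f3 hP hn s0 sb2 sb3 hm hm'
    · exact hL.no_fork hG (hPC h0) (hbA _ h2) h03 h02 hp hq k1 k2 (fun h => e1 p hp h k1) hU hX.sub
        hX.mem h0x (hX.far _ h0) (hbX _ h3) (hbX _ h2) (hbx _ h3) (hbx _ h2) f3 f2 hP hn s0 sb3 sb2
        hm hm'
  obtain ⟨y, hy, hby⟩ := hL.ay _ (hbA _ h2)
  obtain ⟨y', hy', hby'⟩ := hL.ay _ (hbA _ h3)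
  have hvY : ∀ y ∈ Y, y ≠ v' := fun y hy h => hL.disj_ay v' hv' (h ▸ hy)
  obtain ⟨z, hz, hvz⟩ := hL.ay v' hv'
  -- If `z` sees one of the parents, one further step inside `Y` gives the fork. If not, the path
  -- descends through `K` to `y`, and `Pth.extend` compares it with the adjacent vertex `y'`,
  -- swapping roles if `y'` is met early.
  by_cases hz2 : G.Adj (b c₂) z
  · have hadj := hyy z hz y' hy' hz2 hby'
    exact hfork z y' ∅ 0 hz hy' (Set.empty_subset _) far_empty far_empty (Or.inl ⟨hz2, hby'⟩)
      (pth_of_adj _ hvz) ((pth_of_adj _ hvz).snoc hadj.symm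
        (hG.sep hadj hvz.symm (hvY y' hy').symm) far_empty)
  by_cases hz3 : G.Adj (b c₃) z
  · have hadj := hyy y hy z hz hby hz3
    exact hfork z y ∅ 0 hz hy (Set.empty_subset _) far_empty far_empty (Or.inr ⟨hz3, hby⟩)
      (pth_of_adj _ hvz) ((pth_of_adj _ hvz).snoc hadj
        (hG.sep hadj.symm hvz.symm (hvY y hy).symm) far_empty)
  have hadj := hyy y hy y' hy' hby hby'
  obtain ⟨k, hk, hzk⟩ := hL.yk z hz
  obtain ⟨k', hk', hyk'⟩ := hL.yk y hy
  have hvU : v' ∉ insert z K := by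
    rintro (h | h)
    · exact hvY z hz h.symm
    · exact (hL.far_ak v' hv' v' h).1 rfl
  have hyU : ∀ y ∈ Y, y ≠ z → y ∉ insert z K := by
    rintro y hy hyz (h | h)
    · exact hyz h
    · exact hL.disj_yk y hy h
  obtain ⟨m, hm⟩ := (hL.conn.insert hk hzk).exists_pth ⟨z, Or.inl rfl, hvz⟩ ⟨k', Or.inr hk', hyk'⟩
    hvU (hyU y hy (fun h => hz2 (h ▸ hby))) (hvY y hy)
  have hU : insert z K ⊆ K ∪ Y :=
    Set.insert_subset (Or.inr hz) Set.subset_union_left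
  have f2 := (hL.far_ak _ (hbA _ h2)).insert (hAY _ (hbA _ h2) z hz hz2)
  have f3 := (hL.far_ak _ (hbA _ h3)).insert (hAY _ (hbA _ h3) z hz hz3)
  rcases hm.extend hadj.symm (hvY y' hy') (hyU y' hy' (fun h => hz3 (h ▸ hby'))) with
    h | ⟨i, h, ⟨w, k1, k2⟩ | h'⟩
  · exact hfork y y' _ m hy hy' hU f2 f3 (Or.inl ⟨hby, hby'⟩) hm h
  · exact hG.not_triangle k1 hadj k2
  · exact hfork y' y _ i hy' hy hU f2 f3 (Or.inr ⟨hby', hby⟩) h h'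

/-- There is no pentagon of active vertices. -/
theorem Indexed.no_active_pent (hG : Pentagonal G) (hI : Indexed G K Y A C b idx)
    (hN : ∀ v, ColOn G (N2 G v) t) (hPC : P ⊆ C) (hP : ∀ w ∈ P, Active G C idx (8 * t + 5) w)
    {c₀ c₁ c₂ c₃ c₄ : V} (h0 : c₀ ∈ P) (h1 : c₁ ∈ P) (h2 : c₂ ∈ P) (h3 : c₃ ∈ P)
    (h4 : c₄ ∈ P) (hp : Pent G c₀ c₁ c₂ c₃ c₄) : False := by
  obtain ⟨X₁, hXC, hX, hcol, hfar, hlt, x, hxC, hxX, hxlt, hwx, hq⟩ :=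
    exists_exit_of_active hG (m := 8 * t) [c₀, c₁, c₂, c₃, c₄] (by simp) (by
      intro w hw
      apply hP
      simp only [List.mem_cons, List.not_mem_nil, or_false] at hw
      rcases hw with rfl | rfl | rfl | rfl | rfl <;> assumption)
  have hPr : Probe G C idx (8 * t) {w | w ∈ [c₀, c₁, c₂, c₃, c₄]} X₁ x :=
    ⟨hXC, hX, hcol, hfar, hlt, hxC, hxX, hxlt, hq⟩
  have hsub : {w | w ∈ [c₀, c₁, c₂, c₃, c₄]} ⊆ P := by
    intro w hw
    simp only [List.mem_cons, List.not_mem_nil, or_false, Set.mem_ofPred_eq] at hw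
    rcases hw with rfl | rfl | rfl | rfl | rfl <;> assumption
  have hedge : ∀ u ∈ P, ∀ v ∈ P, G.Adj u v → ∀ y ∈ Y, G.Adj (b u) y → G.Adj (b v) y → False :=
    fun u hu v hv huv y hy hyu hyv => hI.no_active_edge hG hN (hPC hu) (hPC hv)
      ((hP u hu).mono (by omega)) ((hP v hv).mono (by omega)) huv hy hyu hyv
  have key : ∀ d₀ ∈ [c₀, c₁, c₂, c₃, c₄], ∀ d₁ ∈ [c₀, c₁, c₂, c₃, c₄], ∀ d₂ ∈ [c₀, c₁, c₂, c₃, c₄],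
      ∀ d₃ ∈ [c₀, c₁, c₂, c₃, c₄], ∀ d₄ ∈ [c₀, c₁, c₂, c₃, c₄], Pent G d₀ d₁ d₂ d₃ d₄ →
      G.Adj d₀ x → False := by
    intro d₀ h0 d₁ h1 d₂ h2 d₃ h3 d₄ h4 hp h0x
    have hQC := hsub.trans hPC
    -- Without triangles, `d₂` and `d₃` are the only other pentagon vertices that `x` can see.
    by_cases h2x : G.Adj d₂ x
    · exact hI.no_probe_two hG hN hPr hQC h0 h1 h2 h3 h4 hp h0x h2x
    by_cases h3x : G.Adj d₃ x
    · exact hI.no_probe_two hG hN hPr hQC h3 h4 h0 h1 h2 hp.rot.rot.rot h3x h0x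
    exact hI.no_probe_one hG hN hPr hQC
      (fun u hu v hv => hedge u (hsub hu) v (hsub hv)) h0 h1 h2 h3 h4 hp h0x h2x h3x
  have m0 : c₀ ∈ [c₀, c₁, c₂, c₃, c₄] := by simp
  have m1 : c₁ ∈ [c₀, c₁, c₂, c₃, c₄] := by simp
  have m2 : c₂ ∈ [c₀, c₁, c₂, c₃, c₄] := by simp
  have m3 : c₃ ∈ [c₀, c₁, c₂, c₃, c₄] := by simp
  have m4 : c₄ ∈ [c₀, c₁, c₂, c₃, c₄] := by simp
  obtain ⟨w, hw, hwx⟩ := hwx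
  simp only [List.mem_cons, List.not_mem_nil, or_false] at hw
  rcases hw with rfl | rfl | rfl | rfl | rfl
  · exact key _ m0 _ m1 _ m2 _ m3 _ m4 hp hwx
  · exact key _ m1 _ m2 _ m3 _ m4 _ m0 hp.rot hwx
  · exact key _ m2 _ m3 _ m4 _ m0 _ m1 hp.rot.rot hwx
  · exact key _ m3 _ m4 _ m0 _ m1 _ m2 hp.rot.rot.rot hwx
  · exact key _ m4 _ m0 _ m1 _ m2 _ m3 hp.rot.rot.rot.rot hwx

theorem Layers.exists_indexed [Finite V] (hG : Pentagonal G) (hL : Layers G K Y A C) :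
    ∃ b idx, Indexed G K Y A C b idx ∧ ∀ u ∈ C, ∀ v ∈ C, idx u = idx v → ¬ G.Adj u v := by
  obtain ⟨b, idx, h1, h2, h3⟩ := exists_index (fun a => {y | y ∈ Y ∧ G.Adj a y}) hL.ca
  refine ⟨b, idx, ⟨hL, fun c hc => (h1 c hc).1, fun c hc => (h1 c hc).2, ?_, ?_⟩, ?_⟩
  · intro u hu x hx hux
    exact ⟨fun h => hL.disj_ac _ (h1 u hu).1 (h ▸ hx),
      fun h => (h3 u hu x hx hux (b u) (h1 u hu).1 h.symm).1 rfl⟩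
  · intro u hu x hx hux a ha hxa y hy hby hay
    have := (h3 u hu x hx hux a ha hxa).2
    by_contra! hcon
    exact hay (this (fun y hy => ⟨hy.1, hcon y hy.1 hy.2⟩) ⟨hy, hby⟩).2
  · intro u hu v hv h huv
    exact hG.not_triangle huv (h1 v hv).2 (h2 u hu v hv h ▸ (h1 u hu).2)

/-- Nonactive vertices cost `8 * t + 6`, because vertices of equal index share a parent and are
nonadjacent. Active vertices contain no pentagon and cost `2`. -/
theorem Layers.colOn [Finite V] (hG : Pentagonal G) (hL : Layers G K Y A C)
    (hN : ∀ v, ColOn G (N2 G v) t) : ColOn G C (8 * t + 8) := by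
  obtain ⟨b, idx, hI, hidx⟩ := hL.exists_indexed hG
  have h1 : ColOn G {v | v ∈ C ∧ ¬ Active G C idx (8 * t + 5) v} (8 * t + 5 + 1) := by
    refine colOn_nonactive (C := C) (idx := idx)
      (fun n u hu v hv h h' => hidx u hu v hv (h.trans h'.symm)) (fun v hv => hv.1) ?_
    intro v hv X hXC hX hlt hadj
    by_contra hc
    exact hv.2 ⟨X, hXC, hX, hlt, hadj, hc⟩
  have h2 : ColOn G {v | v ∈ C ∧ Active G C idx (8 * t + 5) v} 2 := by
    refine hG.colOn_two ?_
    intro a ha b hb c hc d hd e he hp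
    exact hI.no_active_pent hG hN (fun v hv => hv.1) (fun v hv => hv.2) ha hb hc hd he hp
  refine h1.cover h2 ?_ (by omega)
  intro v hv
  by_cases h : Active G C idx (8 * t + 5) v
  · exact Or.inr ⟨hv, h⟩
  · exact Or.inl ⟨hv, h⟩

end

/-! ### Distance levels -/

/-- The vertices at distance `k` from `z`. -/
def Level (G : SimpleGraph V) (z : V) (k : ℕ) : Set V := {v | G.Reachable z v ∧ G.dist z v = k}

theorem le_of_adj_of_mem_level {z u v : V} {i j : ℕ} (hu : u ∈ Level G z i) (hv : v ∈ Level G z j)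
    (h : G.Adj u v) : j ≤ i + 1 := by
  obtain ⟨p, hp⟩ := hu.1.exists_walk_length_eq_dist
  have := dist_le (p.concat h)
  rwa [Walk.length_concat, hp, hu.2, hv.2] at this

theorem exists_parent {z v : V} {j : ℕ} (hv : v ∈ Level G z (j + 1)) :
    ∃ u ∈ Level G z j, G.Adj v u := by
  obtain ⟨p, hp⟩ := hv.1.symm.exists_walk_length_eq_dist
  rw [dist_comm, hv.2] at hp
  cases p with
  | nil => simp at hp
  | @cons _ u _ h q =>
    rw [Walk.length_cons] at hp
    refine ⟨u, ⟨q.reverse.reachable, ?_⟩, h⟩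
    have h1 := dist_le q.reverse
    rw [Walk.length_reverse] at h1
    have h2 := le_of_adj_of_mem_level ⟨q.reverse.reachable, rfl⟩ hv h.symm
    omega

theorem level_zero (z : V) : Level G z 0 = {z} := by
  ext v
  constructor
  · rintro ⟨h1, h2⟩
    exact (h1.dist_eq_zero_iff.1 h2).symm
  · rintro rfl
    exact ⟨Reachable.refl _, dist_self⟩

theorem connOn_levels (z : V) (j : ℕ) : ConnOn G {v | ∃ i ≤ j, v ∈ Level G z i} := by
  induction j with
  | zero =>
    have : {v | ∃ i ≤ 0, v ∈ Level G z i} = {z} := by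
      rw [← level_zero (G := G)]
      ext v
      simp
    rw [this]
    exact connOn_singleton z
  | succ j ih =>
    have : {v | ∃ i ≤ j + 1, v ∈ Level G z i} = {v | ∃ i ≤ j, v ∈ Level G z i} ∪ Level G z (j + 1) := by
      ext v
      constructor
      · rintro ⟨i, hi, hv⟩
        rcases Nat.lt_or_ge j i with h | h
        · obtain rfl : i = j + 1 := by omega
          exact Or.inr hv
        · exact Or.inl ⟨i, h, hv⟩
      · rintro (⟨i, hi, hv⟩ | hv)
        · exact ⟨i, by omega, hv⟩
        · exact ⟨j + 1, le_rfl, hv⟩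
    rw [this]
    refine ih.union fun v hv => ?_
    obtain ⟨u, hu, huv⟩ := exists_parent hv
    exact ⟨u, ⟨j, le_rfl, hu⟩, huv⟩

theorem sep_of_mem_level {z u v : V} {i j : ℕ} (hu : u ∈ Level G z i) (hv : v ∈ Level G z j)
    (h : i + 2 ≤ j) : Sep G v u := by
  refine ⟨?_, fun k => ?_⟩
  · rintro rfl
    have := hu.2.symm.trans hv.2
    omega
  · have := le_of_adj_of_mem_level hu hv k.symm
    omega

theorem notMem_level {z v : V} {i j : ℕ} (hv : v ∈ Level G z i) (h : i ≠ j) : v ∉ Level G z j :=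
  fun h' => h (hv.2.symm.trans h'.2)

/-- The base is the whole ball of radius `k`, since the level `k` alone need not be connected. -/
theorem layers_level (z : V) (k : ℕ) :
    Layers G {v | ∃ i ≤ k, v ∈ Level G z i} (Level G z (k + 1)) (Level G z (k + 2))
      (Level G z (k + 3)) where
  conn := connOn_levels z k
  yk y hy := by
    obtain ⟨u, hu, h⟩ := exists_parent hy
    exact ⟨u, ⟨k, le_rfl, hu⟩, h⟩
  ay _ ha := exists_parent ha
  ca _ hc := exists_parent hc
  disj_yk := by
    rintro y hy ⟨i, hi, h⟩
    exact notMem_level hy (by omega) h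
  disj_ay _ ha := notMem_level ha (by omega)
  disj_ac _ ha := notMem_level ha (by omega)
  far_ak := by
    rintro a ha v ⟨i, hi, hv⟩
    exact sep_of_mem_level hv ha (by omega)
  far_ck := by
    rintro a ha v ⟨i, hi, hv⟩
    exact sep_of_mem_level hv ha (by omega)
  far_cy c hc v hv := sep_of_mem_level hv hc (by omega)

/-- Edges join equal or consecutive values of `d`, so two palettes alternating with the parity of
`d` suffice. -/
theorem colOn_of_levels {S : Set V} {m : ℕ} (d : V → ℕ)
    (hd : ∀ u ∈ S, ∀ v ∈ S, G.Adj u v → d v ≤ d u + 1)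
    (hm : ∀ k, ColOn G {v | v ∈ S ∧ d v = k} m) : ColOn G S (m + m) := by
  choose f h1 h2 using hm
  refine ⟨fun v => f (d v) v + m * (d v % 2), fun v hv => ?_, fun u hu v hv huv h => ?_⟩
  · have := h1 (d v) v ⟨hv, rfl⟩
    rcases Nat.mod_two_eq_zero_or_one (d v) with h | h <;> simp only [h] <;> omega
  · have k1 := h1 (d u) u ⟨hu, rfl⟩
    have k2 := h1 (d v) v ⟨hv, rfl⟩
    have k3 := hd u hu v hv huv
    have k4 := hd v hv u hu huv.symm
    by_cases he : d v = d u
    · simp only [he, Nat.add_right_cancel_iff] at h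
      exact h2 (d u) u ⟨hu, rfl⟩ v ⟨hv, he⟩ huv h
    · rcases Nat.mod_two_eq_zero_or_one (d v) with h' | h' <;>
        rcases Nat.mod_two_eq_zero_or_one (d u) with h'' | h'' <;>
        simp only [h', h''] at h <;> omega

theorem Pentagonal.colOn_level [Finite V] (hG : Pentagonal G) {t : ℕ}
    (hN : ∀ v, ColOn G (N2 G v) t) (z : V) : ∀ k, ColOn G (Level G z k) (8 * t + 8)
  | 0 => by
    rw [level_zero]
    refine (colOn_one_of_stable ?_).mono subset_rfl (by omega : 1 ≤ 8 * t + 8)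
    rintro _ rfl _ rfl h
    exact h.ne rfl
  | 1 => by
    refine (colOn_one_of_stable ?_).mono subset_rfl (by omega : 1 ≤ 8 * t + 8)
    intro u hu v hv h
    exact hG.not_triangle (dist_eq_one_iff_adj.1 hu.2) h (dist_eq_one_iff_adj.1 hv.2)
  | 2 => by
    refine (hN z).mono ?_ (by omega)
    intro v hv
    have hs : Sep G v z := sep_of_mem_level (level_zero (G := G) z ▸ rfl) hv le_rfl
    obtain ⟨u, hu, h⟩ := exists_parent hv
    exact ⟨hs.symm.1, hs.symm.2, u, dist_eq_one_iff_adj.1 hu.2, h.symm⟩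
  | k + 3 => (layers_level z k).colOn hG hN

/-- If all second neighbourhoods of a pentagonal graph have small chromatic number,
then so has the graph. -/
theorem Pentagonal.colOn_univ_of_N2 [Finite V] (hG : Pentagonal G) {t : ℕ}
    (hN : ∀ v, ColOn G (N2 G v) t) : ColOn G Set.univ (16 * t + 16) := by
  refine colOn_of_comp fun z _ => ?_
  have h : ColOn G {v | G.Reachable z v} ((8 * t + 8) + (8 * t + 8)) :=
    colOn_of_levels (fun v => G.dist z v)
      (fun u hu v hv huv => le_of_adj_of_mem_level ⟨hu, rfl⟩ ⟨hv, rfl⟩ huv)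
      (fun k => hG.colOn_level hN z k)
  refine h.mono (fun v hv => ?_) (by omega)
  exact hv {v | G.Reachable z v} (Set.subset_univ _) (Reachable.refl z)
    fun a ha q _ haq => Reachable.trans ha haq.reachable

/-- The vertices at distance two from `v` in the subgraph induced on `S`. -/
def N2On (G : SimpleGraph V) (S : Set V) (v : V) : Set V :=
  {x | x ∈ S ∧ Sep G v x ∧ ∃ w ∈ S, G.Adj v w ∧ G.Adj w x}

theorem Pentagonal.colOn_of_N2On [Finite V] (hG : Pentagonal G) {S : Set V} {t : ℕ}
    (hN : ∀ v ∈ S, ColOn G (N2On G S v) t) : ColOn G S (16 * t + 16) := by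
  rw [colOn_iff_induce]
  refine (hG.induce S).colOn_univ_of_N2 fun v => ?_
  obtain ⟨f, h1, h2⟩ := hN v v.2
  have key : ∀ x ∈ N2 (G.induce S) v, (x : V) ∈ N2On G S v := by
    rintro x ⟨k1, k2, w, k3, k4⟩
    exact ⟨x.2, ⟨fun h => k1 (Subtype.ext h), k2⟩, w, w.2, k3, k4⟩
  exact ⟨fun x => f x, fun x hx => h1 x (key x hx),
    fun x hx y hy hxy => h2 x (key x hx) y (key y hy) hxy⟩

/-! ### Covers and second neighbourhoods -/

/-- Every vertex of `C` has a neighbour in `A`, and `z` is complete to `A` and anticomplete to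
`C`. -/
structure Cover (G : SimpleGraph V) (z : V) (A C : Set V) : Prop where
  za : ∀ a ∈ A, G.Adj z a
  zc : Far G z C
  ac : ∀ c ∈ C, ∃ a ∈ A, G.Adj a c

theorem Cover.ne {z a c : V} {A C : Set V} (h : Cover G z A C) (ha : a ∈ A) (hc : c ∈ C) : a ≠ c :=
  fun e => (h.zc c hc).2 (e ▸ h.za a ha)

/-- By the rule `hR`, a vertex of `A` or of `B` seeing one vertex of the pentagon must see a second
one, at distance two (`step`). For `A` this is in turn impossible (`fin`): a vertex of `B` over the
middle vertex, with its own second neighbour, forces a triangle. -/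
theorem no_pent_of_rule (hG : Pentagonal G) {A B Q : Set V}
    (hA : ∀ x ∈ Q, ∃ a ∈ A, G.Adj a x) (hB : ∀ x ∈ Q, ∃ b ∈ B, G.Adj b x)
    (hR : ∀ x ∈ Q, ∀ y ∈ Q, ∀ w ∈ Q, G.Adj x y → G.Adj y w → x ≠ w → ∀ a ∈ A, ∀ b ∈ B,
      G.Adj a x → G.Adj b w → G.Adj a w ∨ G.Adj b x)
    {c₀ c₁ c₂ c₃ c₄ : V} (h0 : c₀ ∈ Q) (h1 : c₁ ∈ Q) (h2 : c₂ ∈ Q) (h3 : c₃ ∈ Q) (h4 : c₄ ∈ Q)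
    (hp : Pent G c₀ c₁ c₂ c₃ c₄) : False := by
  have tri : ∀ {a x y : V}, G.Adj x y → G.Adj a x → ¬ G.Adj a y := fun hxy hx hy =>
    hG.not_triangle hx hxy hy
  have step : ∀ (A B : Set V), (∀ x ∈ Q, ∃ a ∈ A, G.Adj a x) → (∀ x ∈ Q, ∃ b ∈ B, G.Adj b x) →
      (∀ x ∈ Q, ∀ y ∈ Q, ∀ w ∈ Q, G.Adj x y → G.Adj y w → x ≠ w → ∀ a ∈ A, ∀ b ∈ B,
        G.Adj a x → G.Adj b w → G.Adj a w ∨ G.Adj b x) →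
      ∀ c₀ ∈ Q, ∀ c₁ ∈ Q, ∀ c₂ ∈ Q, ∀ c₃ ∈ Q, ∀ c₄ ∈ Q, Pent G c₀ c₁ c₂ c₃ c₄ →
      ∀ a ∈ A, G.Adj a c₀ → G.Adj a c₂ ∨ G.Adj a c₃ := by
    intro A B hA hB hR c₀ h0 c₁ h1 c₂ h2 c₃ h3 c₄ h4 hp a ha ha0
    by_contra! hn
    obtain ⟨b₂, hb₂, hb₂'⟩ := hB c₂ h2
    obtain ⟨b₃, hb₃, hb₃'⟩ := hB c₃ h3
    obtain ⟨a₁, ha₁, ha₁'⟩ := hA c₁ h1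
    have k2 := (hR c₀ h0 c₁ h1 c₂ h2 hp.ab hp.bc hp.sep_ac.1.symm a ha b₂ hb₂ ha0 hb₂').resolve_left
      hn.1
    have k3 := (hR c₀ h0 c₄ h4 c₃ h3 hp.ea.symm hp.de.symm hp.refl.sep_ac.1.symm a ha b₃ hb₃ ha0
      hb₃').resolve_left hn.2
    have k1 := (hR c₁ h1 c₂ h2 c₃ h3 hp.bc hp.cd hp.rot.sep_ac.1.symm a₁ ha₁ b₃ hb₃ ha₁'
      hb₃').resolve_right (tri hp.ab k3)
    rcases hR c₃ h3 c₄ h4 c₀ h0 hp.de hp.ea hp.refl.sep_ac.1 a₁ ha₁ b₂ hb₂ k1 k2 with h | h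
    · exact tri hp.ab h ha₁'
    · exact tri hp.cd hb₂' h
  have stepB := step B A hB hA (fun x hx y hy w hw hxy hyw hne b hb a ha hbx haw =>
    (hR w hw y hy x hx hyw.symm hxy.symm hne.symm a ha b hb haw hbx).symm)
  have fin : ∀ c₀ ∈ Q, ∀ c₁ ∈ Q, ∀ c₂ ∈ Q, ∀ c₃ ∈ Q, ∀ c₄ ∈ Q, Pent G c₀ c₁ c₂ c₃ c₄ →
      ∀ a ∈ A, G.Adj a c₀ → ¬ G.Adj a c₂ := by
    intro c₀ h0 c₁ h1 c₂ h2 c₃ h3 c₄ h4 hp a ha ha0 ha2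
    obtain ⟨b, hb, hb1⟩ := hB c₁ h1
    rcases stepB c₁ h1 c₂ h2 c₃ h3 c₄ h4 c₀ h0 hp.rot b hb hb1 with h | h
    · rcases hR c₀ h0 c₄ h4 c₃ h3 hp.ea.symm hp.de.symm hp.refl.sep_ac.1.symm a ha b hb ha0 h with
        k | k
      · exact tri hp.cd ha2 k
      · exact tri hp.ab k hb1
    · rcases hR c₂ h2 c₃ h3 c₄ h4 hp.cd hp.de hp.rot.rot.sep_ac.1.symm a ha b hb ha2 h with k | k
      · exact tri hp.ea k ha0
      · exact tri hp.bc hb1 k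
  obtain ⟨a, ha, ha0⟩ := hA c₀ h0
  rcases step A B hA hB hR c₀ h0 c₁ h1 c₂ h2 c₃ h3 c₄ h4 hp a ha ha0 with h | h
  · exact fin c₀ h0 c₁ h1 c₂ h2 c₃ h3 c₄ h4 hp a ha ha0 h
  · exact fin c₀ h0 c₄ h4 c₃ h3 c₂ h2 c₁ h1 hp.refl a ha ha0 h

/-- The rule of `no_pent_of_rule` holds with `B` the neighbours of `v` in `C`. Let `a'` be a parent
of `b`; it misses `v`, hence every vertex of this set. If the rule failed, `a, x, y, w, b, a', z`
would be an induced cycle of length seven. -/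
theorem Cover.colOn_bad (hG : Pentagonal G) {z v : V} {A C : Set V} (h : Cover G z A C) :
    ColOn G {x | x ∈ N2On G C v ∧ ∀ a ∈ A, G.Adj a x → G.Adj a v} 2 := by
  refine hG.colOn_two ?_
  intro c₀ h0 c₁ h1 c₂ h2 c₃ h3 c₄ h4 hp
  refine no_pent_of_rule hG (A := A) (B := {b | b ∈ C ∧ G.Adj v b})
    (Q := {x | x ∈ N2On G C v ∧ ∀ a ∈ A, G.Adj a x → G.Adj a v}) ?_ ?_ ?_ h0 h1 h2 h3 h4 hp
  · rintro x ⟨hx, -⟩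
    exact h.ac x hx.1
  · rintro x ⟨⟨-, -, w, hw, hvw, hwx⟩, -⟩
    exact ⟨w, ⟨hw, hvw⟩, hwx⟩
  · rintro x hx y hy w hw hxy hyw hxw a ha b ⟨hb, hvb⟩ hax hbw
    by_contra! hn
    have hav := hx.2 a ha hax
    obtain ⟨a', ha', ha'b⟩ := h.ac b hb
    have ha'v : ¬ G.Adj a' v := fun k => hG.not_triangle k hvb ha'b
    have hne : a ≠ a' := by
      rintro rfl
      exact ha'v hav
    have hsep : ∀ q ∈ {x | x ∈ N2On G C v ∧ ∀ a ∈ A, G.Adj a x → G.Adj a v}, Sep G a' q :=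
      fun q hq => ⟨(h.ne ha' hq.1.1).symm, fun k => ha'v (hq.2 a' ha' k)⟩
    have hbne : ∀ q ∈ {x | x ∈ N2On G C v ∧ ∀ a ∈ A, G.Adj a x → G.Adj a v}, q ≠ b := by
      rintro q hq rfl
      exact hq.1.2.1.2 hvb
    have hzC := h.zc
    have q1 := (pth_of_adj ∅ hxy).snoc hyw.symm (hG.sep hxy.symm hyw hxw.symm).symm far_empty
    have q2 := q1.snoc hbw ⟨hbne x hx, hn.2⟩
      (far_empty.insert (hG.sep hyw.symm hbw.symm (hbne y hy).symm).symm)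
    have q3 := q2.snoc ha'b (hsep x hx) ((far_empty.insert (hsep y hy)).insert (hsep w hw))
    have q4 := q3.snoc (h.za a' ha') (hzC x hx.1.1)
      (((far_empty.insert (hzC y hy.1.1)).insert (hzC w hw.1.1)).insert (hzC b hb))
    have hay : Sep G a y := (hG.sep hxy hax.symm (h.ne ha hy.1.1)).symm
    have := q4.close hG hax (h.za a ha).symm
      ((((far_empty.insert hay).insert ⟨(h.ne ha hw.1.1).symm, hn.1⟩).insert
        (hG.sep hav.symm hvb (h.ne ha hb).symm)).insert (hG.sep (h.za a ha) (h.za a' ha') hne.symm))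
    omega

/-- There are no induced paths with a positive even number of interior vertices, all in `C`, from
`A` to `B`. -/
def NoEvenPath (G : SimpleGraph V) (A B C : Set V) : Prop :=
  ∀ a ∈ A, ∀ b ∈ B, ∀ n, Pth G a b C n → n % 2 = 0 → n = 0

theorem NoEvenPath.mono {A B C A' B' C' : Set V} (h : NoEvenPath G A B C) (hA : A' ⊆ A)
    (hB : B' ⊆ B) (hC : C' ⊆ C) : NoEvenPath G A' B' C' :=
  fun a ha b hb n hP hn => h a (hA ha) b (hB hb) n (hP.mono hC) hn

/-- Passing to a second neighbourhood of a vertex of a covered set yields a second cover such that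
paths between the two covers are controlled. -/
theorem Cover.exists_good (hG : Pentagonal G) {z v : V} {A C : Set V} (h : Cover G z A C)
    (hv : v ∈ C) : ∃ D ⊆ N2On G C v, ColOn G (N2On G C v \ D) 3 ∧
      (∀ x ∈ D, ∃ a ∈ A, ¬ G.Adj a v ∧ G.Adj a x) ∧
      NoEvenPath G {a | a ∈ A ∧ ¬ G.Adj a v} {b | b ∈ C ∧ G.Adj v b} D := by
  obtain ⟨av, hav, havv⟩ := h.ac v hv
  -- The two conditions discard the bipartite set of `Cover.colOn_bad` and the stable neighbourhood
  -- of `av`, whence `3`. A path from `a` to `b` with `n` interior vertices then closes through `v,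
  -- av, z` to a cycle of length `n + 5`.
  refine ⟨{x | x ∈ N2On G C v ∧ (∃ a ∈ A, ¬ G.Adj a v ∧ G.Adj a x) ∧ ¬ G.Adj av x},
    fun x hx => hx.1, ?_, fun x hx => hx.2.1, ?_⟩
  · have h1 : ColOn G {x | G.Adj av x} 1 :=
      colOn_one_of_stable fun u hu w hw huw => hG.not_triangle hu huw hw
    refine (h.colOn_bad hG (v := v)).cover h1 ?_ le_rfl
    rintro x ⟨hx, hxn⟩
    by_cases hxa : G.Adj av x
    · exact Or.inr hxa
    · refine Or.inl ⟨hx, fun a ha hax => ?_⟩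
      by_contra hav'
      exact hxn ⟨hx, ⟨a, ha, hav', hax⟩, hxa⟩
  · rintro a ⟨ha, hav'⟩ b ⟨hb, hvb⟩ n hP hn
    have q1 := hP.snoc hvb ⟨h.ne ha hv, fun k => hav' k.symm⟩ (fun x hx => hx.1.2.1)
    have hne : a ≠ av := by
      rintro rfl
      exact hav' havv
    have q2 := q1.snoc havv (hG.sep (h.za av hav) (h.za a ha) hne)
      (Far.insert (fun x hx => ⟨(h.ne hav hx.1.1).symm, hx.2.2⟩)
        (hG.sep havv.symm hvb (h.ne hav hb).symm))
    have := q2.close hG (h.za a ha) (h.za av hav)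
      ((h.zc.mono (Set.insert_subset hb fun x hx => hx.1.1)).insert (h.zc v hv))
    omega

/-- Otherwise `a, x, y, b` is an induced path with two interior vertices. -/
theorem NoEvenPath.adj (hG : Pentagonal G) {A B C : Set V} (h : NoEvenPath G A B C) {a b x y : V}
    (ha : a ∈ A) (hb : b ∈ B) (hx : x ∈ C) (hy : y ∈ C) (hxy : G.Adj x y) (hax : G.Adj a x)
    (hby : G.Adj b y) : G.Adj a b := by
  by_contra hn
  have hbx : ¬ G.Adj b x := fun k => hG.not_triangle k hxy hby
  have hay : ¬ G.Adj a y := fun k => hG.not_triangle hax hxy k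
  have q1 := (pth_of_adj ∅ hax).snoc hxy.symm ⟨fun e => hn (e ▸ hby.symm), fun k => hay k.symm⟩
    far_empty
  have q2 := q1.snoc hby ⟨fun e => hbx (e ▸ hax), fun k => hn k.symm⟩
    (far_empty.insert ⟨fun e => hn (e ▸ hax), hbx⟩)
  have := h a ha b hb _ (q2.mono (by
    rintro v (rfl | rfl | h)
    · exact hy
    · exact hx
    · exact h.elim)) rfl
  omega

/-- Otherwise `a, c₀, c₄, c₃, c₂, b` is an induced path with four interior vertices;
`NoEvenPath.adj` removes its chords at `c₃` and `c₄`. -/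
theorem NoEvenPath.adj_or_adj (hG : Pentagonal G) {A B C : Set V} (h : NoEvenPath G A B C)
    {a b c₀ c₁ c₂ c₃ c₄ : V} (hp : Pent G c₀ c₁ c₂ c₃ c₄) (ha : a ∈ A) (hb : b ∈ B) (h0 : c₀ ∈ C)
    (h2 : c₂ ∈ C) (h3 : c₃ ∈ C) (h4 : c₄ ∈ C) (ha0 : G.Adj a c₀) (hb2 : G.Adj b c₂)
    (hab : ¬ G.Adj a b) : G.Adj a c₂ ∨ G.Adj b c₀ := by
  by_contra! hn
  have ha3 : ¬ G.Adj a c₃ := fun k => hab (h.adj hG ha hb h3 h2 hp.cd.symm k hb2)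
  have hb4 : ¬ G.Adj b c₄ := fun k => hab (h.adj hG ha hb h0 h4 hp.ea.symm ha0 k)
  have ha4 : ¬ G.Adj a c₄ := fun k => hG.not_triangle ha0 hp.ea.symm k
  have hb3 : ¬ G.Adj b c₃ := fun k => hG.not_triangle hb2 hp.cd k
  have sa4 : Sep G a c₄ := ⟨fun e => ha3 (e ▸ hp.de.symm), ha4⟩
  have sa3 : Sep G a c₃ := ⟨fun e => hn.1 (e ▸ hp.cd.symm), ha3⟩
  have sa2 : Sep G a c₂ := ⟨fun e => hab (e ▸ hb2.symm), hn.1⟩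
  have sb0 : Sep G b c₀ := ⟨fun e => hab (e ▸ ha0), hn.2⟩
  have sb4 : Sep G b c₄ := ⟨fun e => hn.2 (e ▸ hp.ea), hb4⟩
  have sb3 : Sep G b c₃ := ⟨fun e => hb4 (e ▸ hp.de), hb3⟩
  have sab : Sep G b a := ⟨fun e => hn.2 (e ▸ ha0), fun k => hab k.symm⟩
  have q1 := (pth_of_adj ∅ ha0).snoc hp.ea sa4.symm far_empty
  have q2 := q1.snoc hp.de sa3.symm (far_empty.insert hp.rot.rot.rot.sep_ac)
  have q3 := q2.snoc hp.cd sa2.symm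
    ((far_empty.insert hp.sep_ac.symm).insert hp.rot.rot.sep_ac)
  have q4 := q3.snoc hb2 sab (((far_empty.insert sb0).insert sb4).insert sb3)
  have := h a ha b hb _ (q4.mono (by
    rintro v (rfl | rfl | rfl | rfl | h) <;> first | assumption | exact h.elim)) rfl
  omega

/-- Three sets which cover `C`, such that paths between any two of them are controlled,
exclude pentagons in `C`. -/
theorem no_pent_of_three_covers (hG : Pentagonal G) {A₁ A₂ A₃ C : Set V}
    (h1 : ∀ x ∈ C, ∃ a ∈ A₁, G.Adj a x) (h2 : ∀ x ∈ C, ∃ a ∈ A₂, G.Adj a x)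
    (h3 : ∀ x ∈ C, ∃ a ∈ A₃, G.Adj a x) (h12 : NoEvenPath G A₁ A₂ C) (h13 : NoEvenPath G A₁ A₃ C)
    (h23 : NoEvenPath G A₂ A₃ C)
    {c₀ c₁ c₂ c₃ c₄ : V} (m0 : c₀ ∈ C) (m1 : c₁ ∈ C) (m2 : c₂ ∈ C) (m3 : c₃ ∈ C) (m4 : c₄ ∈ C)
    (hp : Pent G c₀ c₁ c₂ c₃ c₄) : False := by
  obtain ⟨α, hα, hα0⟩ := h1 c₀ m0
  -- A member of the third cover over the middle vertex `c₁` would be adjacent to both `α` and `β`.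
  have n2 : ∀ c₁ ∈ C, ∀ c₂ ∈ C, G.Adj c₀ c₁ → G.Adj c₁ c₂ → ∀ β ∈ A₂, G.Adj β c₂ → ¬ G.Adj α β := by
    intro c₁ m1 c₂ m2 h01 h12' β hβ hβ2 hαβ
    obtain ⟨γ, hγ, hγ1⟩ := h3 c₁ m1
    exact hG.not_triangle hαβ (h23.adj hG hβ hγ m2 m1 h12'.symm hβ2 hγ1)
      (h13.adj hG hα hγ m0 m1 h01 hα0 hγ1)
  have n3 : ∀ c₁ ∈ C, ∀ c₂ ∈ C, G.Adj c₀ c₁ → G.Adj c₁ c₂ → ∀ γ ∈ A₃, G.Adj γ c₂ → ¬ G.Adj α γ := by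
    intro c₁ m1 c₂ m2 h01 h12' γ hγ hγ2 hαγ
    obtain ⟨β, hβ, hβ1⟩ := h2 c₁ m1
    exact hG.not_triangle (h12.adj hG hα hβ m0 m1 h01 hα0 hβ1)
      (h23.adj hG hβ hγ m1 m2 h12' hβ1 hγ2) hαγ
  obtain ⟨β₂, hβ₂, hβ₂'⟩ := h2 c₂ m2
  obtain ⟨γ₂, hγ₂, hγ₂'⟩ := h3 c₂ m2
  obtain ⟨γ₃, hγ₃, hγ₃'⟩ := h3 c₃ m3
  have e2 := h13.adj_or_adj hG hp hα hγ₂ m0 m2 m3 m4 hα0 hγ₂'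
    (n3 c₁ m1 c₂ m2 hp.ab hp.bc γ₂ hγ₂ hγ₂')
  have nγ₃ := n3 c₄ m4 c₃ m3 hp.ea.symm hp.de.symm γ₃ hγ₃ hγ₃'
  have e3 := h13.adj_or_adj hG hp.refl hα hγ₃ m0 m3 m2 m1 hα0 hγ₃' nγ₃
  have hα2 : ¬ G.Adj α c₂ := fun k => nγ₃ (h13.adj hG hα hγ₃ m2 m3 hp.cd k hγ₃')
  have hα3 : ¬ G.Adj α c₃ := fun k => n3 c₁ m1 c₂ m2 hp.ab hp.bc γ₂ hγ₂ hγ₂'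
    (h13.adj hG hα hγ₂ m3 m2 hp.cd.symm k hγ₂')
  -- Both `β₂` and `γ₃` see `c₀`, while the edge from `c₂` to `c₃` makes them adjacent: a triangle.
  have hβ0 := (h12.adj_or_adj hG hp hα hβ₂ m0 m2 m3 m4 hα0 hβ₂'
    (n2 c₁ m1 c₂ m2 hp.ab hp.bc β₂ hβ₂ hβ₂')).resolve_left hα2
  exact hG.not_triangle (h23.adj hG hβ₂ hγ₃ m2 m3 hp.cd hβ₂' hγ₃') (e3.resolve_left hα3) hβ0

/-- The covers are the vertices of `A` missing `v₂` and `v₃`, the neighbours of `v₂` in `C` missing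
`v₃`, and the neighbours of `v₃` in `D`. The first pair is controlled by `hDP`, the others by two
uses of `Cover.exists_good`, each discarding `3` colours; the rest is bipartite, so `8 = 2 + 3 + 3`.
-/
theorem Pentagonal.colOn_three_covers (hG : Pentagonal G) {z v₂ v₃ : V} {A C D : Set V}
    (h : Cover G z A C) (hD : D ⊆ N2On G C v₂)
    (hDA : ∀ x ∈ D, ∃ a ∈ A, ¬ G.Adj a v₂ ∧ G.Adj a x)
    (hDP : NoEvenPath G {a | a ∈ A ∧ ¬ G.Adj a v₂} {b | b ∈ C ∧ G.Adj v₂ b} D) (hv₃ : v₃ ∈ D) :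
    ColOn G (N2On G D v₃) 8 := by
  have hc1 : Cover G z {a | a ∈ A ∧ ¬ G.Adj a v₂} D := by
    refine ⟨fun a ha => h.za a ha.1, h.zc.mono fun x hx => (hD hx).1, fun x hx => ?_⟩
    obtain ⟨a, k1, k2, k3⟩ := hDA x hx
    exact ⟨a, ⟨k1, k2⟩, k3⟩
  have hc2 : Cover G v₂ {b | b ∈ C ∧ G.Adj v₂ b} D := by
    refine ⟨fun a ha => ha.2, fun x hx => (hD hx).2.1, fun x hx => ?_⟩
    obtain ⟨-, -, w, k1, k2, k3⟩ := hD hx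
    exact ⟨w, ⟨k1, k2⟩, k3⟩
  obtain ⟨E, hE, hEc, hEA, hEP⟩ := hc1.exists_good hG hv₃
  obtain ⟨F, hF, hFc, hFA, hFP⟩ := hc2.exists_good hG hv₃
  have h2 : ColOn G (E ∩ F) 2 := by
    refine hG.colOn_two ?_
    intro c₀ m0 c₁ m1 c₂ m2 c₃ m3 c₄ m4 hp
    refine no_pent_of_three_covers hG (C := E ∩ F) ?_ ?_ ?_
      (hDP.mono (fun a ha => ha.1) (fun a ha => ha.1) (fun x hx => (hE hx.1).1))
      (hEP.mono subset_rfl subset_rfl Set.inter_subset_left)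
      (hFP.mono subset_rfl subset_rfl Set.inter_subset_right) m0 m1 m2 m3 m4 hp
    · intro x hx
      obtain ⟨a, k1, k2, k3⟩ := hEA x hx.1
      exact ⟨a, ⟨k1, k2⟩, k3⟩
    · intro x hx
      obtain ⟨a, k1, k2, k3⟩ := hFA x hx.2
      exact ⟨a, ⟨k1, k2⟩, k3⟩
    · intro x hx
      obtain ⟨-, -, w, k1, k2, k3⟩ := hE hx.1
      exact ⟨w, ⟨k1, k2⟩, k3⟩
  refine (h2.union (hEc.union hFc)).mono (fun x hx => ?_) le_rfl
  by_cases hxE : x ∈ E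
  · by_cases hxF : x ∈ F
    · exact Or.inl ⟨hxE, hxF⟩
    · exact Or.inr (Or.inr ⟨hx, hxF⟩)
  · exact Or.inr (Or.inl ⟨hx, hxE⟩)

/-! ### Numerical bound and conclusion -/

/-- Every finite pentagonal graph is `37904`-colourable. -/
theorem Pentagonal.colorable [Finite V] (hG : Pentagonal G) : G.Colorable 37904 := by
  rw [← colOn_univ_iff]
  -- From the inside out: `144 = 16 * 8 + 16`, `147 = 144 + 3`, `2368 = 16 * 147 + 16`, `37904 = 16
  -- * 2368 + 16`.
  refine hG.colOn_univ_of_N2 (t := 2368) fun z => hG.colOn_of_N2On (t := 147) fun v₂ hv₂ => ?_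
  have h : Cover G z {a | G.Adj z a} (N2 G z) := by
    refine ⟨fun a ha => ha, fun x hx => ⟨hx.1, hx.2.1⟩, fun x hx => ?_⟩
    obtain ⟨-, -, w, k1, k2⟩ := hx
    exact ⟨w, k1, k2⟩
  obtain ⟨D, hD, hDc, hDA, hDP⟩ := h.exists_good hG hv₂
  have hcol : ColOn G D 144 := hG.colOn_of_N2On (t := 8) fun v₃ hv₃ =>
    hG.colOn_three_covers h hD hDA hDP hv₃
  refine hcol.cover hDc (fun x hx => ?_) le_rfl
  by_cases hxD : x ∈ D
  · exact Or.inl hxD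
  · exact Or.inr ⟨hx, hxD⟩

theorem pentagonal_of_clique_of_hole
    (h1 : ∀ s : Finset V, G.IsClique (s : Set V) → s.card ≤ 2)
    (h2 : ∀ n : ℕ, Odd n → HasHole G n → n ≤ 5) : Pentagonal G := by
  classical
  intro n hn hc
  rw [Nat.odd_iff] at hn
  have h3 := hc.1
  rcases Nat.lt_or_ge n 4 with h | h
  · obtain rfl : n = 3 := by omega
    exfalso
    obtain ⟨-, ⟨f⟩⟩ := hc
    have := h1 (Finset.univ.map f.toEmbedding) (by
      intro x hx y hy hxy
      simp only [Finset.coe_map, Finset.coe_univ, Set.image_univ, Set.mem_range] at hx hy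
      obtain ⟨i, rfl⟩ := hx
      obtain ⟨j, rfl⟩ := hy
      refine f.map_rel_iff.2 ?_
      rw [cycleGraph_three_eq_top, top_adj]
      rintro rfl
      exact hxy rfl)
    simp at this
  · have := h2 n (Nat.odd_iff.2 hn) ⟨h, hc⟩
    omega

theorem Pentagonal.chromaticNumber_le [Finite V] (hG : Pentagonal G) :
    G.chromaticNumber ≤ 58000 :=
  (hG.colorable.mono (by norm_num : 37904 ≤ 58000)).chromaticNumber_le

end GyarfasHoles

theorem mainTheorem1 :
    (∀ (V : Type u) [Finite V] (G : SimpleGraph V),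
      GyarfasHoles.Pentagonal G → G.chromaticNumber ≤ 58000) ∧
    GyarfasHoles.GyarfasConjecture.{u} 2 5 := by
  refine ⟨fun V _ G hG => hG.chromaticNumber_le, 58000, fun V _ G h1 h2 => ?_⟩
  exact_mod_cast (GyarfasHoles.pentagonal_of_clique_of_hole h1 h2).chromaticNumber_le
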